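/- Let $\mathcal{T}^{(3)}$ be the 3-ary tree: the infinite rooted tree in which the root $\rho$ has 3 neighbours and every other vertex has 4 neighbours. Let $\mathbf{X}=\{X_t,\ t\ge 0\}$ be the vertex-reinforced jump process (VRJP) on $\mathcal{T}^{(3)}$ started at $X_0=\rho$, that is, the right-continuous process that jumps only between neighbouring vertices and such that, given $X_s$, $0\le s\le t$, and $X_t=x$, the conditional probability of a jump to a neighbour $y$ of $x$ during $(t,t+dt)$ is $L(y,t)\,dt$, where $$L(y,t):=1+\int_0^t \mathbf{1}_{\{X_s=y\}}\,ds .$$ Then $\mathbf{X}$ is transient: with positive probability, after it first leaves $\rho$ it never returns to $\rho$. Moreover $\mathbf{X}$ drifts to infinity: almost surely, every vertex of $\mathcal{T}^{(3)}$ is visited only finitely many times. -/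

import Mathlib

open MeasureTheory Set
open scoped NNReal ProbabilityTheory

noncomputable section

/-- The `b`-ary tree. Vertices are the finite words in `b` letters, the root is the empty word, and
the children of the word `u` are the words `i :: u`. So the root has `b` neighbours, and every other
vertex has `b + 1` of them. -/
def aryTree (b : ℕ) : SimpleGraph (List (Fin b)) where
  Adj u v := (∃ i, v = i :: u) ∨ (∃ i, u = i :: v)
  symm := ⟨fun _ _ h => h.symm⟩
  loopless := ⟨fun u h => by
    rcases h with ⟨i, h⟩ | ⟨i, h⟩ <;> simpa using congrArg List.length h⟩

theorem aryTree_neighborSet_finite (b : ℕ) (u : List (Fin b)) :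
    ((aryTree b).neighborSet u).Finite := by
  refine ((Set.finite_range fun i : Fin b => i :: u).union (Set.finite_singleton u.tail)).subset ?_
  rintro v (⟨i, rfl⟩ | ⟨i, h⟩)
  · exact Or.inl ⟨i, rfl⟩
  · right
    simp [h]

instance aryTreeLocallyFinite (b : ℕ) : (aryTree b).LocallyFinite :=
  fun u => (aryTree_neighborSet_finite b u).fintype

section VRJP

variable {V Ω : Type*}

/-- `L(y, t) = 1 + ∫₀ᵗ 1{X_s = y} ds`. -/
def reinforcement (X : ℝ≥0 → Ω → V) (y : V) (t : ℝ≥0) (ω : Ω) : ℝ :=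
  1 + ∫ s in (0 : ℝ)..t, {r : ℝ | X r.toNNReal ω = y}.indicator (fun _ => (1 : ℝ)) s

/-- The time of the `n`-th jump, for the holding times `W 0, W 1, …`. -/
def jumpTime (W : ℕ → Ω → ℝ≥0) (n : ℕ) (ω : Ω) : ℝ≥0 :=
  ∑ k ∈ Finset.range n, W k ω

/-- What is known at the `n`-th jump: the σ-algebra generated by the positions `Y 0, …, Y n` and the
holding times `W 0, …, W (n - 1)`. -/
abbrev history (Y : ℕ → Ω → V) (W : ℕ → Ω → ℝ≥0) (n : ℕ) : MeasurableSpace Ω :=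
  (⨆ k ∈ Set.Iic n, MeasurableSpace.comap (Y k) ⊤) ⊔
    (⨆ k ∈ Set.Iio n, MeasurableSpace.comap (W k) inferInstance)

/-- The total rate at which the process leaves the vertex `x` at time `t`. -/
def totalRate (G : SimpleGraph V) [G.LocallyFinite] (X : ℝ≥0 → Ω → V) (x : V) (t : ℝ≥0)
    (ω : Ω) : ℝ :=
  ∑ y ∈ G.neighborFinset x, reinforcement X y t ω

open Classical in
/-- `X` is a vertex-reinforced jump process on `G` started at `ρ`, with successive positions
`Y 0, Y 1, …` and successive holding times `W 0, W 1, …`: while `X` sits at `x`, it jumps to each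
neighbour `y` of `x` at rate `L(y, t)`. During a stay at `x` these rates do not change, because
`L(y, ·)` grows only while the process is at `y`. So, given the past at the `n`-th jump, the
next holding time is exponential with parameter the sum of the rates, and, independently of it, the
next position is `y` with probability proportional to `L(y, ·)`. -/
structure IsVRJPWith [MeasurableSpace Ω] (G : SimpleGraph V) [G.LocallyFinite] (ρ : V)
    (P : Measure Ω) (X : ℝ≥0 → Ω → V) (Y : ℕ → Ω → V) (W : ℕ → Ω → ℝ≥0) : Prop where
  measurable_position : ∀ n, Measurable[_, ⊤] (Y n)
  measurable_holding : ∀ n, Measurable (W n)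
  start : ∀ᵐ ω ∂P, Y 0 ω = ρ
  path : ∀ᵐ ω ∂P, ∀ n t, jumpTime W n ω ≤ t → t < jumpTime W (n + 1) ω → X t ω = Y n ω
  jump : ∀ (n : ℕ) (t : ℝ≥0) (y : V),
    P⟦{ω | t < W n ω ∧ Y (n + 1) ω = y} | history Y W n⟧ =ᵐ[P] fun ω =>
      if G.Adj (Y n ω) y then
        reinforcement X y (jumpTime W n ω) ω / totalRate G X (Y n ω) (jumpTime W n ω) ω *
          Real.exp (-(totalRate G X (Y n ω) (jumpTime W n ω) ω * t))
      else 0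

/-- `X = (X_t)_{t ≥ 0}` is a vertex-reinforced jump process on `G` started at `ρ`. -/
def IsVRJP [MeasurableSpace Ω] (G : SimpleGraph V) [G.LocallyFinite] (ρ : V)
    (P : Measure Ω) (X : ℝ≥0 → Ω → V) : Prop :=
  ∃ (Y : ℕ → Ω → V) (W : ℕ → Ω → ℝ≥0), IsVRJPWith G ρ P X Y W

/-- With positive probability the process, which starts at `ρ`, leaves `ρ` at some time `s` and does
not return to it. -/
def IsTransient [MeasurableSpace Ω] (ρ : V) (P : Measure Ω) (X : ℝ≥0 → Ω → V) : Prop :=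
  0 < P {ω | ∃ s : ℝ≥0, ∀ t : ℝ≥0, X t ω = ρ ↔ t < s}

/-- The times at which a visit to `v` begins: the process is at `v` at time `t`, and it was not at
`v` throughout any time interval `[r, t)` with `r < t` (for `t = 0` there is no such interval). -/
def visits (X : ℝ≥0 → Ω → V) (v : V) (ω : Ω) : Set ℝ≥0 :=
  {t | X t ω = v ∧ ∀ r < t, ∃ s ∈ Ico r t, X s ω ≠ v}

/-- Almost surely, every vertex is visited only finitely many times. -/
def DriftsToInfinity [MeasurableSpace Ω] (P : Measure Ω) (X : ℝ≥0 → Ω → V) : Prop :=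
  ∀ᵐ ω ∂P, ∀ v : V, (visits X v ω).Finite

end VRJP

end

/-!
Write `L x` for the local time of `x` (increased by `1`), and look at an edge whose parent and child
have local times `p` and `z`. At the parent the process crosses it at rate `z` while `p` grows, at
the child it crosses it at rate `p` while `z` grows, and nothing else affects the edge. A function
`g d p z` of these quantities and of the side `d` of the process is therefore a martingale as soon
as `∂g(parent)/∂p + z (g(child) - g(parent)) = 0` and `∂g(child)/∂z + p (g(parent) - g(child)) = 0`
(`IsEdgeMartingale`). On a tree no two edges are crossed at once, so products of such functions over
different edges are again martingales (`hasDerivAt_edgeProduct`, `lintegral_edgeProduct_succ`).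

Two explicit solutions suffice: `firstMoment`, equal to `z / p` at the parent, and `secondMoment`,
equal to `z² / p² + z / p³` at the parent, which dominates the square of the first. The product of
`firstMoment` along the path to `v` is a martingale that equals `L v / L ρ` when the process is at
the root `ρ`; let `M` be its mean over the vertices `v` of a level. At the root, as long as that
level has not been reached, `M = 1 / L ρ`. The square of `M` is dominated by a mean of martingales
`pairProduct v w` over pairs of vertices; since local times are at least `1`, each common edge of
the two paths costs at most a factor `2`, and `2 < 3` makes the mean at most `2 / (L ρ)²`, uniformly
in the level (`sum_level_two_pow`, `pairMean_nil_le`).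

So `M` is bounded in `L²` and cannot concentrate on an event of small probability, whereas returns
to the root with an increased local time force `M` to be small. Optional stopping turns this into
`measure_le_of_stopping`: the probability of not being stopped by such returns is bounded below.
Stopping at the first return to the root gives a positive probability of no return
(`measure_no_return_pos`). Stopping when `L ρ` has doubled gives, from each visit to the root, a
probability at least `1 / 8` that this never happens, whence `L ρ` stays bounded almost surely
(`ae_bddAbove_localTime_nil`).

The maximal inequality for the positive martingale above, which is at least `L v / L ρ`, shows that
then every `L v` stays bounded. Infinitely many visits to `v` would, the exit rates being bounded,
contain infinitely many stays longer than `1`, by Lévy's Borel–Cantelli lemma, and make `L v`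
unbounded; so there are finitely many. In the same way the process does not explode, which transfers
everything from the jump chain to continuous time.
-/

/-! ### Exponential waiting times -/

section ExponentialClock

/-- The fundamental theorem of calculus on `(a, ∞)` for a function decreasing to zero. -/
theorem lintegral_Ioi_of_hasDerivAt_neg {F f : ℝ → ℝ} {a : ℝ}
    (hderiv : ∀ t ∈ Ici a, HasDerivAt F (-f t) t) (hf : ∀ t ∈ Ioi a, 0 ≤ f t)
    (hF : Filter.Tendsto F Filter.atTop (nhds 0)) :
    ∫⁻ t in Ioi a, ENNReal.ofReal (f t) = ENNReal.ofReal (F a) := by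
  have hneg : ∀ t ∈ Ioi a, -f t ≤ 0 := fun t ht => neg_nonpos.2 (hf t ht)
  have hint := (integrableOn_Ioi_deriv_of_nonpos' hderiv hneg hF).neg
  have hval := integral_Ioi_of_hasDerivAt_of_nonpos' hderiv hneg hF
  have hint' : IntegrableOn f (Ioi a) := by simpa [Pi.neg_def] using hint
  rw [← ofReal_integral_eq_lintegral_ofReal hint']
  · rw [integral_neg] at hval
    congr 1
    linarith
  · exact (ae_restrict_iff' measurableSet_Ioi).2 (Filter.Eventually.of_forall hf)

theorem lintegral_Ioi_mul_exp_neg_mul {a R : ℝ} (ha : 0 ≤ a) (hR : 0 < R) (t : ℝ) :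
    ∫⁻ w in Ioi t, ENNReal.ofReal (a * Real.exp (-(R * w))) =
      ENNReal.ofReal (a / R * Real.exp (-(R * t))) := by
  apply lintegral_Ioi_of_hasDerivAt_neg (F := fun w => a / R * Real.exp (-(R * w)))
  · intro w _
    have h1 : HasDerivAt (fun w : ℝ => -(R * w)) (-(R * 1)) w :=
      ((hasDerivAt_id w).const_mul R).neg
    refine ((h1.exp).const_mul (a / R)).congr_deriv ?_
    field_simp
  · intro w _
    positivity
  · have : Filter.Tendsto (fun w : ℝ => Real.exp (-(R * w))) Filter.atTop (nhds 0) :=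
      Real.tendsto_exp_neg_atTop_nhds_zero.comp (Filter.tendsto_id.const_mul_atTop hR)
    simpa using this.const_mul (a / R)

/-- If, given the σ-algebra of `X`, the event `B ∩ {W > t}` has conditional probability
`(a / R) exp (-R t)`, then on `B` the variable `W` has conditional density `a exp (-R w)`. -/
theorem lintegral_eq_of_measure_exp_tail {Ω E : Type*} [MeasurableSpace Ω] [MeasurableSpace E]
    {P : Measure Ω} [IsFiniteMeasure P] {X : Ω → E} (hX : Measurable X) {W : Ω → ℝ}
    (hW : Measurable W) {B : Set Ω} {a R : E → ℝ} (ha : Measurable a)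
    (hR : Measurable R) (ha0 : ∀ e, 0 ≤ a e) (hR0 : ∀ e, 0 < R e)
    (hlaw : ∀ C : Set E, MeasurableSet C → ∀ t : ℝ, 0 ≤ t →
      P (X ⁻¹' C ∩ (B ∩ {ω | t < W ω})) =
        ∫⁻ ω in X ⁻¹' C, ENNReal.ofReal (a (X ω) / R (X ω) * Real.exp (-(R (X ω) * t))) ∂P)
    {h : E × ℝ → ENNReal} (hh : Measurable h) :
    ∫⁻ ω in B ∩ {ω | 0 < W ω}, h (X ω, W ω) ∂P =
      ∫⁻ ω, (∫⁻ w in Ioi (0 : ℝ),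
        ENNReal.ofReal (a (X ω) * Real.exp (-(R (X ω) * w))) * h (X ω, w)) ∂P := by
  have hpos : MeasurableSet {ω | 0 < W ω} := measurableSet_lt measurable_const hW
  have hXW : Measurable fun ω => (X ω, W ω) := hX.prodMk hW
  have hdens : Measurable fun e : E × ℝ => ENNReal.ofReal (a e.1 * Real.exp (-(R e.1 * e.2))) := by
    fun_prop
  set μ₁ : Measure (E × ℝ) := (P.restrict (B ∩ {ω | 0 < W ω})).map fun ω => (X ω, W ω) with hμ₁
  set μ₂ : Measure (E × ℝ) := ((P.map X).prod (volume.restrict (Ioi 0))).withDensity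
    fun e => ENNReal.ofReal (a e.1 * Real.exp (-(R e.1 * e.2))) with hμ₂
  have hrect : ∀ C : Set E, MeasurableSet C → ∀ t : ℝ, μ₁ (C ×ˢ Ioi t) = μ₂ (C ×ˢ Ioi t) := by
    intro C hC t
    have hCt : MeasurableSet (C ×ˢ Ioi t) := hC.prod measurableSet_Ioi
    rw [hμ₁, Measure.map_apply hXW hCt, Measure.restrict_apply (hXW hCt), hμ₂,
      withDensity_apply _ hCt, ← Measure.prod_restrict, lintegral_prod _ hdens.aemeasurable,
      Measure.restrict_restrict measurableSet_Ioi, Ioi_inter_Ioi]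
    have hset : (fun ω => (X ω, W ω)) ⁻¹' C ×ˢ Ioi t ∩ (B ∩ {ω | 0 < W ω}) =
        X ⁻¹' C ∩ (B ∩ {ω | t ⊔ 0 < W ω}) := by
      ext ω
      simp only [mem_inter_iff, mem_preimage, mem_prod, mem_Ioi, mem_ofPred_eq, sup_lt_iff]
      tauto
    rw [hset, hlaw C hC _ le_sup_right]
    simp only [lintegral_Ioi_mul_exp_neg_mul (ha0 _) (hR0 _)]
    rw [Measure.restrict_map hX hC, lintegral_map _ hX]
    fun_prop
  have hfin : IsFiniteMeasure μ₁ := by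
    rw [hμ₁]
    infer_instance
  -- Both measures are finite and agree on the rectangles `C ×ˢ Ioi t`.
  have hμ : μ₁ = μ₂ := by
    refine Measure.ext_prod fun {C T} hC hT => ?_
    have hsnd : ∀ (μ : Measure (E × ℝ)) (T : Set ℝ), MeasurableSet T →
        (μ.restrict (C ×ˢ univ)).map Prod.snd T = μ (C ×ˢ T) := by
      intro μ T hT
      rw [Measure.map_apply measurable_snd hT, Measure.restrict_apply (measurable_snd hT)]
      congr 1
      ext e
      simp [and_comm]
    rw [← hsnd μ₁ T hT, ← hsnd μ₂ T hT]
    congr 1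
    refine Measure.ext_of_generateFrom_of_iUnion (range Ioi) (fun n : ℕ => Ioi (-(n : ℝ)))
      (BorelSpace.measurable_eq.trans (borel_eq_generateFrom_Ioi ℝ)) isPiSystem_Ioi ?_
      (fun n => mem_range_self _) (fun n => measure_ne_top _ _) ?_
    · refine eq_univ_of_forall fun r => mem_iUnion.2 ?_
      obtain ⟨n, hn⟩ := exists_nat_gt (-r)
      exact ⟨n, by simp only [mem_Ioi]; linarith⟩
    · rintro _ ⟨t, rfl⟩
      rw [hsnd _ _ measurableSet_Ioi, hsnd _ _ measurableSet_Ioi, hrect C hC t]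
  calc ∫⁻ ω in B ∩ {ω | 0 < W ω}, h (X ω, W ω) ∂P = ∫⁻ e, h e ∂μ₁ := by
        rw [hμ₁, lintegral_map hh hXW]
    _ = ∫⁻ e, h e ∂μ₂ := by rw [hμ]
    _ = _ := by
        rw [hμ₂, lintegral_withDensity_eq_lintegral_mul _ hdens hh, lintegral_prod]
        · simp only [Pi.mul_apply]
          rw [lintegral_map _ hX]
          exact (hdens.mul hh).lintegral_prod_right'
        · exact (hdens.mul hh).aemeasurable

end ExponentialClock

/-! ### Local times of the jump chain -/

section Chain

variable {V Ω : Type*}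

open Classical in
/-- The local time of the vertex `v` at the `n`-th jump, including the initial value `1`. -/
noncomputable def localTime (Y : ℕ → Ω → V) (W : ℕ → Ω → ℝ≥0) (n : ℕ) (v : V) (ω : Ω) : ℝ :=
  1 + ∑ k ∈ Finset.range n, if Y k ω = v then (W k ω : ℝ) else 0

theorem localTime_zero (Y : ℕ → Ω → V) (W : ℕ → Ω → ℝ≥0) (v : V) (ω : Ω) :
    localTime Y W 0 v ω = 1 := by
  simp [localTime]

open Classical in
theorem localTime_succ (Y : ℕ → Ω → V) (W : ℕ → Ω → ℝ≥0) (n : ℕ) (v : V) (ω : Ω) :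
    localTime Y W (n + 1) v ω =
      localTime Y W n v ω + if Y n ω = v then (W n ω : ℝ) else 0 := by
  simp only [localTime, Finset.sum_range_succ, add_assoc]

theorem localTime_mono (Y : ℕ → Ω → V) (W : ℕ → Ω → ℝ≥0) (v : V) (ω : Ω) :
    Monotone fun n => localTime Y W n v ω := by
  refine monotone_nat_of_le_succ fun n => ?_
  rw [localTime_succ]
  split_ifs <;> simp

theorem one_le_localTime (Y : ℕ → Ω → V) (W : ℕ → Ω → ℝ≥0) (n : ℕ) (v : V) (ω : Ω) :
    1 ≤ localTime Y W n v ω :=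
  (localTime_zero Y W v ω).symm.le.trans (localTime_mono Y W v ω n.zero_le)

theorem localTime_pos (Y : ℕ → Ω → V) (W : ℕ → Ω → ℝ≥0) (n : ℕ) (v : V) (ω : Ω) :
    0 < localTime Y W n v ω :=
  zero_lt_one.trans_le (one_le_localTime Y W n v ω)

theorem localTime_succ_eq_update [DecidableEq V] (Y : ℕ → Ω → V) (W : ℕ → Ω → ℝ≥0) (n : ℕ) (ω : Ω) :
    (fun v => localTime Y W (n + 1) v ω) =
      Function.update (fun v => localTime Y W n v ω) (Y n ω)
        (localTime Y W n (Y n ω) ω + W n ω) := by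
  funext v
  by_cases h : v = Y n ω
  · subst h
    simp [localTime_succ]
  · rw [Function.update_of_ne h, localTime_succ, if_neg (Ne.symm h), add_zero]

theorem localTime_eq_one {Y : ℕ → Ω → V} {W : ℕ → Ω → ℝ≥0} {n : ℕ} {v : V} {ω : Ω}
    (h : ∀ k < n, Y k ω ≠ v) : localTime Y W n v ω = 1 := by
  rw [localTime, Finset.sum_eq_zero, add_zero]
  intro k hk
  rw [if_neg (h k (Finset.mem_range.1 hk))]

theorem localTime_le_one_add_jumpTime (Y : ℕ → Ω → V) (W : ℕ → Ω → ℝ≥0) (n : ℕ) (v : V) (ω : Ω) :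
    localTime Y W n v ω ≤ 1 + jumpTime W n ω := by
  rw [localTime, jumpTime, NNReal.coe_sum]
  gcongr
  split_ifs <;> simp

open Classical in
/-- Along a path that sits at `Y k` during the `k`-th holding interval, the reinforcement at the
jump times is the local time of the jump chain. -/
theorem reinforcement_jumpTime {X : ℝ≥0 → Ω → V} {Y : ℕ → Ω → V} {W : ℕ → Ω → ℝ≥0} {ω : Ω}
    (hpath : ∀ n t, jumpTime W n ω ≤ t → t < jumpTime W (n + 1) ω → X t ω = Y n ω) (y : V) (n : ℕ) :
    reinforcement X y (jumpTime W n ω) ω = localTime Y W n y ω := by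
  rw [reinforcement, localTime]
  congr 1
  set f : ℝ → ℝ := {r : ℝ | X r.toNNReal ω = y}.indicator fun _ => (1 : ℝ) with hf
  suffices H : IntervalIntegrable f volume 0 (jumpTime W n ω) ∧
      ∫ s in (0 : ℝ)..jumpTime W n ω, f s =
        ∑ k ∈ Finset.range n, if Y k ω = y then (W k ω : ℝ) else 0 from H.2
  induction n with
  | zero => simp [jumpTime]
  | succ n ih =>
    have hT : (jumpTime W (n + 1) ω : ℝ) = jumpTime W n ω + W n ω := by
      simp [jumpTime, Finset.sum_range_succ]
    have hle : (jumpTime W n ω : ℝ) ≤ jumpTime W (n + 1) ω := by simp [hT]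
    have hconst : ∀ᵐ s : ℝ, s ∈ uIoc (jumpTime W n ω : ℝ) (jumpTime W (n + 1) ω) →
        f s = if Y n ω = y then 1 else 0 := by
      have hne : ∀ᵐ s : ℝ, s ≠ jumpTime W (n + 1) ω := by simp [ae_iff]
      filter_upwards [hne] with s hs hmem
      rw [uIoc_of_le hle] at hmem
      have hs0 : 0 ≤ s := (NNReal.coe_nonneg _).trans hmem.1.le
      have hX : X s.toNNReal ω = Y n ω := by
        apply hpath
        · rw [← NNReal.coe_le_coe, Real.coe_toNNReal _ hs0]
          exact hmem.1.le
        · rw [← NNReal.coe_lt_coe, Real.coe_toNNReal _ hs0]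
          exact lt_of_le_of_ne hmem.2 hs
      simp [hf, indicator_apply, hX]
    have hint : IntervalIntegrable f volume (jumpTime W n ω) (jumpTime W (n + 1) ω) := by
      refine (intervalIntegrable_const (c := if Y n ω = y then (1 : ℝ) else 0)).congr_ae ?_
      refine (ae_restrict_iff' measurableSet_uIoc).2 ?_
      filter_upwards [hconst] with s hs hmem using (hs hmem).symm
    refine ⟨ih.1.trans hint, ?_⟩
    rw [← intervalIntegral.integral_add_adjacent_intervals ih.1 hint, ih.2,
      Finset.sum_range_succ, intervalIntegral.integral_congr_ae hconst,
      intervalIntegral.integral_const, hT]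
    split_ifs <;> simp

/-! ### The σ-algebras of the past -/

theorem history_mono (Y : ℕ → Ω → V) (W : ℕ → Ω → ℝ≥0) : Monotone (history Y W) := by
  intro m n hmn
  refine sup_le_sup ?_ ?_
  · exact biSup_mono fun k hk => le_trans hk hmn
  · exact biSup_mono fun k hk => lt_of_lt_of_le hk hmn

theorem measurable_position_history (Y : ℕ → Ω → V) (W : ℕ → Ω → ℝ≥0) {k n : ℕ} (h : k ≤ n) :
    Measurable[history Y W n, ⊤] (Y k) := by
  rw [measurable_iff_comap_le]
  exact le_sup_of_le_left (le_biSup (fun k => MeasurableSpace.comap (Y k) ⊤) h)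

theorem measurable_holding_history (Y : ℕ → Ω → V) (W : ℕ → Ω → ℝ≥0) {k n : ℕ} (h : k < n) :
    Measurable[history Y W n] (W k) := by
  rw [measurable_iff_comap_le]
  exact le_sup_of_le_right
    (le_biSup (fun k => MeasurableSpace.comap (W k) inferInstance) (mem_Iio.2 h))

theorem measurableSet_position_eq (Y : ℕ → Ω → V) (W : ℕ → Ω → ℝ≥0) {k n : ℕ} (h : k ≤ n) (v : V) :
    MeasurableSet[history Y W n] {ω | Y k ω = v} :=
  measurable_position_history Y W h (t := {v}) trivial

theorem measurable_localTime (Y : ℕ → Ω → V) (W : ℕ → Ω → ℝ≥0) (n : ℕ) (v : V) :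
    Measurable[history Y W n] (localTime Y W n v) := by
  classical
  refine measurable_const.add (Finset.measurable_sum _ fun k hk => ?_)
  have hk' := Finset.mem_range.1 hk
  exact Measurable.ite (measurableSet_position_eq Y W hk'.le v)
    (measurable_holding_history Y W hk').coe_nnreal_real measurable_const

/-- The history as a filtration. -/
def historyFiltration [m : MeasurableSpace Ω] (Y : ℕ → Ω → V) (W : ℕ → Ω → ℝ≥0)
    (hY : ∀ n, Measurable[_, ⊤] (Y n)) (hW : ∀ n, Measurable (W n)) : Filtration ℕ m where
  seq := history Y W
  mono' := history_mono Y W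
  le' _ := sup_le (iSup₂_le fun k _ => measurable_iff_comap_le.1 (hY k))
    (iSup₂_le fun k _ => measurable_iff_comap_le.1 (hW k))

end Chain

/-! ### One step of the process -/

section Step

variable {V Ω : Type*}

/-- The total jump rate out of `x` when the local times are `L`. -/
def exitRate (G : SimpleGraph V) [G.LocallyFinite] (x : V) (L : V → ℝ) : ℝ :=
  ∑ y ∈ G.neighborFinset x, L y

theorem measurable_exitRate {G : SimpleGraph V} [G.LocallyFinite] (Y : ℕ → Ω → V) (W : ℕ → Ω → ℝ≥0)
    (n : ℕ) (x : V) : Measurable[history Y W n] fun ω => exitRate G x (localTime Y W n · ω) :=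
  Finset.measurable_sum _ fun y _ => measurable_localTime Y W n y

theorem exitRate_pos {G : SimpleGraph V} [G.LocallyFinite] {Y : ℕ → Ω → V} {W : ℕ → Ω → ℝ≥0}
    {x : V} (hx : (G.neighborFinset x).Nonempty) (n : ℕ) (ω : Ω) :
    0 < exitRate G x (localTime Y W n · ω) :=
  Finset.sum_pos (fun y _ => localTime_pos Y W n y ω) hx

variable [mΩ : MeasurableSpace Ω] {G : SimpleGraph V} [G.LocallyFinite] {ρ : V}
  {P : Measure Ω} {X : ℝ≥0 → Ω → V} {Y : ℕ → Ω → V} {W : ℕ → Ω → ℝ≥0}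

theorem IsVRJPWith.history_le (h : IsVRJPWith G ρ P X Y W) (n : ℕ) : history Y W n ≤ mΩ :=
  (historyFiltration Y W h.measurable_position h.measurable_holding).le n

theorem IsVRJPWith.reinforcement_eq (h : IsVRJPWith G ρ P X Y W) :
    ∀ᵐ ω ∂P, ∀ n y, reinforcement X y (jumpTime W n ω) ω = localTime Y W n y ω := by
  filter_upwards [h.path] with ω hω n y using reinforcement_jumpTime hω y n

open Classical in
/-- The law of the next jump, integrated over an event of the past. -/
theorem IsVRJPWith.measure_inter_jump [IsProbabilityMeasure P] (h : IsVRJPWith G ρ P X Y W)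
    (n : ℕ) {C : Set Ω} (hC : MeasurableSet[history Y W n] C) (t : ℝ≥0) (y : V) :
    P (C ∩ {ω | t < W n ω ∧ Y (n + 1) ω = y}) =
      ∫⁻ ω in C, ENNReal.ofReal (if G.Adj (Y n ω) y then
        localTime Y W n y ω / exitRate G (Y n ω) (localTime Y W n · ω) *
          Real.exp (-(exitRate G (Y n ω) (localTime Y W n · ω) * t)) else 0) ∂P := by
  set S : Set Ω := {ω | t < W n ω ∧ Y (n + 1) ω = y}
  have hS : MeasurableSet S :=
    (measurableSet_lt measurable_const (h.measurable_holding n)).inter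
      (h.measurable_position (n + 1) (t := {y}) trivial)
  set f : Ω → ℝ := fun ω => if G.Adj (Y n ω) y then
        localTime Y W n y ω / exitRate G (Y n ω) (localTime Y W n · ω) *
          Real.exp (-(exitRate G (Y n ω) (localTime Y W n · ω) * t)) else 0 with hf
  have hle := h.history_le n
  have hcond : P⟦S | history Y W n⟧ =ᵐ[P] f := by
    filter_upwards [h.jump n t y, h.reinforcement_eq] with ω h1 h2
    rw [h1]
    simp only [hf, totalRate, exitRate, h2]
  have hf0 : ∀ ω, 0 ≤ f ω := by
    intro ω
    simp only [hf]
    split_ifs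
    · have h1 := localTime_pos Y W n y ω
      have h2 : 0 ≤ exitRate G (Y n ω) (localTime Y W n · ω) :=
        Finset.sum_nonneg fun y _ => (localTime_pos Y W n y ω).le
      positivity
    · exact le_rfl
  have hfint : Integrable f P := integrable_condExp.congr hcond
  have hind : Integrable (S.indicator fun _ => (1 : ℝ)) P := (integrable_const 1).indicator hS
  have key : ∫ ω in C, f ω ∂P = P.real (C ∩ S) := by
    rw [← integral_congr_ae (ae_restrict_of_ae hcond), setIntegral_condExp hle hind hC,
      setIntegral_indicator hS]
    simp
  rw [← ofReal_integral_eq_lintegral_ofReal hfint.integrableOn (Filter.Eventually.of_forall hf0),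
    key, measureReal_def, ENNReal.ofReal_toReal (measure_ne_top _ _)]

open Classical in
/-- The joint law of the holding time and the past, on the event of a jump from `x` to `y`. -/
theorem IsVRJPWith.lintegral_edge [IsProbabilityMeasure P] (h : IsVRJPWith G ρ P X Y W)
    (n : ℕ) {x y : V} (hxy : G.Adj x y) {H : Ω → ℝ → ENNReal}
    (hH : @Measurable _ _ ((history Y W n).prod inferInstance) _ fun e : Ω × ℝ => H e.1 e.2) :
    ∫⁻ ω in {ω | (Y n ω = x ∧ Y (n + 1) ω = y) ∧ (0 : ℝ) < W n ω}, H ω (W n ω) ∂P =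
      ∫⁻ ω in {ω | Y n ω = x}, (∫⁻ w in Ioi (0 : ℝ), ENNReal.ofReal (localTime Y W n y ω *
        Real.exp (-(exitRate G x (localTime Y W n · ω) * w))) * H ω w) ∂P := by
  have hle := h.history_le n
  have hx := measurableSet_position_eq Y W (le_refl n) x
  have hnon : (G.neighborFinset x).Nonempty := ⟨y, by simpa using hxy⟩
  have key := @lintegral_eq_of_measure_exp_tail Ω Ω mΩ (history Y W n) P _ id
    (measurable_id'' hle) (fun ω => (W n ω : ℝ)) (h.measurable_holding n).coe_nnreal_real
    {ω | Y n ω = x ∧ Y (n + 1) ω = y}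
    ({ω | Y n ω = x}.indicator (localTime Y W n y))
    (fun ω => exitRate G x (localTime Y W n · ω))
    ((measurable_localTime Y W n y).indicator hx) (measurable_exitRate Y W n x)
    (fun ω => indicator_nonneg (fun ω _ => (localTime_pos Y W n y ω).le) ω)
    (fun ω => exitRate_pos hnon n ω) ?_ _ hH
  · refine key.trans ?_
    rw [← lintegral_indicator (hle _ hx)]
    refine lintegral_congr fun ω => ?_
    by_cases hω : Y n ω = x <;> simp [indicator, hω]
  · intro C hC t ht
    lift t to ℝ≥0 using ht
    have hset : id ⁻¹' C ∩ ({ω | Y n ω = x ∧ Y (n + 1) ω = y} ∩ {ω | (t : ℝ) < W n ω}) =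
        (C ∩ {ω | Y n ω = x}) ∩ {ω | t < W n ω ∧ Y (n + 1) ω = y} := by
      ext ω
      simp only [preimage_id, mem_inter_iff, mem_ofPred_eq, NNReal.coe_lt_coe]
      tauto
    rw [hset, h.measure_inter_jump n (MeasurableSet.inter hC hx), inter_comm C,
      ← setLIntegral_indicator (hle _ hx), preimage_id]
    refine lintegral_congr fun ω => ?_
    by_cases hω : Y n ω = x <;> simp [indicator, hω, hxy]

/-- The waiting times are positive, and the jumps are made along edges. -/
theorem IsVRJPWith.ae_adj [Countable V] [IsProbabilityMeasure P] (h : IsVRJPWith G ρ P X Y W)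
    (hG : ∀ x, (G.neighborFinset x).Nonempty) (n : ℕ) :
    ∀ᵐ ω ∂P, G.Adj (Y n ω) (Y (n + 1) ω) ∧ 0 < W n ω := by
  classical
  have hle := h.history_le n
  have hS : ∀ y, MeasurableSet {ω | 0 < W n ω ∧ Y (n + 1) ω = y} := fun y =>
    (measurableSet_lt measurable_const (h.measurable_holding n)).inter
      (h.measurable_position (n + 1) (t := {y}) trivial)
  -- The jump probabilities at time `0` add up to `1`.
  have key : ∀ x, P ({ω | Y n ω = x} \
      ⋃ y ∈ G.neighborFinset x, ({ω | Y n ω = x} ∩ {ω | 0 < W n ω ∧ Y (n + 1) ω = y})) = 0 := by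
    intro x
    have hx := measurableSet_position_eq Y W (le_refl n) x
    have hsub : (⋃ y ∈ G.neighborFinset x,
        ({ω | Y n ω = x} ∩ {ω | 0 < W n ω ∧ Y (n + 1) ω = y})) ⊆ {ω | Y n ω = x} :=
      iUnion₂_subset fun y _ => inter_subset_left
    have hmeas : MeasurableSet (⋃ y ∈ G.neighborFinset x,
        ({ω | Y n ω = x} ∩ {ω | 0 < W n ω ∧ Y (n + 1) ω = y})) :=
      Finset.measurableSet_biUnion _ fun y _ => (hle _ hx).inter (hS y)
    rw [measure_sdiff hsub hmeas.nullMeasurableSet (measure_ne_top _ _), tsub_eq_zero_iff_le,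
      measure_biUnion_finset]
    · simp_rw [h.measure_inter_jump n hx]
      rw [← lintegral_finsetSum' _ fun y _ => ?_]
      · rw [← setLIntegral_one]
        refine (setLIntegral_congr_fun (hle _ hx) fun ω hω => ?_).le
        have hω' : Y n ω = x := hω
        have hpos := exitRate_pos (Y := Y) (W := W) (hG x) n ω
        simp only [hω', NNReal.coe_zero, mul_zero, neg_zero, Real.exp_zero, mul_one]
        rw [← ENNReal.ofReal_sum_of_nonneg]
        · rw [Finset.sum_congr rfl fun y hy => if_pos ((G.mem_neighborFinset x y).1 hy),
            ← Finset.sum_div]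
          rw [show ∑ y ∈ G.neighborFinset x, localTime Y W n y ω =
            exitRate G x (localTime Y W n · ω) from rfl, div_self hpos.ne', ENNReal.ofReal_one]
        · intro y _
          have := localTime_pos Y W n y ω
          split_ifs <;> positivity
      · refine AEMeasurable.congr (f := fun ω => ENNReal.ofReal (if G.Adj x y then
          localTime Y W n y ω / exitRate G x (localTime Y W n · ω) *
            Real.exp (-(exitRate G x (localTime Y W n · ω) * (0 : ℝ≥0))) else 0)) ?_ ?_
        · have h1 := (measurable_localTime Y W n y).mono hle le_rfl
          have h2 := (measurable_exitRate (G := G) Y W n x).mono hle le_rfl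
          split_ifs <;> fun_prop
        · refine (ae_restrict_iff' (hle _ hx)).2 (Filter.Eventually.of_forall fun ω hω => ?_)
          have hω' : Y n ω = x := hω
          simp only [hω']
    · intro y _ y' _ hyy
      refine disjoint_left.2 fun ω hω hω' => hyy ?_
      exact hω.2.2.symm.trans hω'.2.2
    · exact fun y _ => (hle _ hx).inter (hS y)
  have hall : ∀ᵐ ω ∂P, ∀ x, ω ∉ {ω | Y n ω = x} \
      ⋃ y ∈ G.neighborFinset x, ({ω | Y n ω = x} ∩ {ω | 0 < W n ω ∧ Y (n + 1) ω = y}) :=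
    ae_all_iff.2 fun x => measure_eq_zero_iff_ae_notMem.1 (key x)
  filter_upwards [hall] with ω hω
  have := hω (Y n ω)
  simp only [mem_sdiff, mem_ofPred_eq, true_and, not_not, mem_iUnion, mem_inter_iff,
    SimpleGraph.mem_neighborFinset] at this
  obtain ⟨y, hy, hW, rfl⟩ := this
  exact ⟨hy, hW⟩

/-- The law of one step of the chain: the Markov property given the history. -/
theorem IsVRJPWith.lintegral_step [Countable V] [IsProbabilityMeasure P]
    (h : IsVRJPWith G ρ P X Y W) (hG : ∀ x, (G.neighborFinset x).Nonempty) (n : ℕ)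
    {H : V → V → Ω → ℝ → ENNReal}
    (hH : ∀ x y, @Measurable _ _ ((history Y W n).prod inferInstance) _
      fun e : Ω × ℝ => H x y e.1 e.2) :
    ∫⁻ ω, H (Y n ω) (Y (n + 1) ω) ω (W n ω) ∂P =
      ∫⁻ ω, (∑ y ∈ G.neighborFinset (Y n ω), ∫⁻ w in Ioi (0 : ℝ),
        ENNReal.ofReal (localTime Y W n y ω *
          Real.exp (-(exitRate G (Y n ω) (localTime Y W n · ω) * w))) * H (Y n ω) y ω w) ∂P := by
  classical
  have hle := h.history_le n
  have hx := measurableSet_position_eq Y W (le_refl n)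
  have hA : ∀ x y, MeasurableSet {ω | (Y n ω = x ∧ Y (n + 1) ω = y) ∧ (0 : ℝ) < W n ω} :=
    fun x y => ((hle _ (hx x)).inter (h.measurable_position (n + 1) (t := {y}) trivial)).inter
      (measurableSet_lt measurable_const (h.measurable_holding n).coe_nnreal_real)
  have hHW : ∀ x y, Measurable fun ω => H x y ω (W n ω) := by
    intro x y
    have : @Measurable Ω (Ω × ℝ) mΩ ((history Y W n).prod inferInstance)
        fun ω => (ω, (W n ω : ℝ)) :=
      @Measurable.prodMk _ mΩ _ _ (history Y W n) _ id _ (measurable_id'' hle)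
        (h.measurable_holding n).coe_nnreal_real
    exact (hH x y).comp this
  have hK : ∀ x y, Measurable fun ω => ∫⁻ w in Ioi (0 : ℝ), ENNReal.ofReal (localTime Y W n y ω *
      Real.exp (-(exitRate G x (localTime Y W n · ω) * w))) * H x y ω w := by
    intro x y
    refine Measurable.mono (ma := history Y W n) ?_ hle le_rfl
    refine @Measurable.lintegral_prod_right' _ _ (history Y W n) _ _ _
      (fun e : Ω × ℝ => ENNReal.ofReal (localTime Y W n y e.1 *
        Real.exp (-(exitRate G x (localTime Y W n · e.1) * e.2))) *
        H x y e.1 e.2) ?_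
    refine Measurable.mul ?_ (hH x y)
    have hfst := @measurable_fst Ω ℝ (history Y W n) Real.measurableSpace
    have h1 := (measurable_localTime Y W n y).comp hfst
    have h2 := (measurable_exitRate (G := G) Y W n x).comp hfst
    exact (h1.mul (Real.measurable_exp.comp
      (h2.mul (@measurable_snd Ω ℝ (history Y W n) Real.measurableSpace)).neg)).ennreal_ofReal
  have hsplit : (fun ω => H (Y n ω) (Y (n + 1) ω) ω (W n ω)) =ᵐ[P] fun ω =>
      ∑' x, ∑ y ∈ G.neighborFinset x,
        {ω | (Y n ω = x ∧ Y (n + 1) ω = y) ∧ (0 : ℝ) < W n ω}.indicator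
          (fun ω => H x y ω (W n ω)) ω := by
    filter_upwards [h.ae_adj hG n] with ω hω
    rw [tsum_eq_single (Y n ω), Finset.sum_eq_single (Y (n + 1) ω)]
    · simp [indicator, hω.2]
    · intro y _ hy
      simp [indicator, hy.symm]
    · intro hy
      exact absurd hω.1 (by simpa using hy)
    · intro x hxx
      exact Finset.sum_eq_zero fun y _ => by simp [indicator, hxx.symm]
  rw [lintegral_congr_ae hsplit, lintegral_tsum fun x => (Finset.measurable_sum _ fun y _ =>
    (hHW x y).indicator (hA x y)).aemeasurable]
  have hterm : ∀ x, ∫⁻ ω, ∑ y ∈ G.neighborFinset x,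
        {ω | (Y n ω = x ∧ Y (n + 1) ω = y) ∧ (0 : ℝ) < W n ω}.indicator
          (fun ω => H x y ω (W n ω)) ω ∂P =
      ∫⁻ ω, {ω | Y n ω = x}.indicator (fun ω => ∑ y ∈ G.neighborFinset x,
        ∫⁻ w in Ioi (0 : ℝ), ENNReal.ofReal (localTime Y W n y ω *
          Real.exp (-(exitRate G x (localTime Y W n · ω) * w))) * H x y ω w) ω ∂P := by
    intro x
    rw [lintegral_finsetSum _ fun y _ => (hHW x y).indicator (hA x y),
      lintegral_indicator (hle _ (hx x)), lintegral_finsetSum _ fun y _ => hK x y]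
    refine Finset.sum_congr rfl fun y hy => ?_
    rw [lintegral_indicator (hA x y), h.lintegral_edge n (by simpa using hy) (hH x y)]
  simp_rw [hterm]
  rw [← lintegral_tsum fun x => ((Finset.measurable_sum _ fun y _ => hK x y).indicator
    (hle _ (hx x))).aemeasurable]
  refine lintegral_congr fun ω => ?_
  rw [tsum_eq_single (Y n ω)]
  · simp [indicator]
  · intro x hxx
    simp [indicator, hxx.symm]

end Step

/-! ### Products of edge martingales -/

section EdgeMartingale

/-- A function `g d p z` of the local times `p` and `z` of the parent and of the child of an edge,
and of the side `d` of the edge on which the process is (`true` for the child's side), that is a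
martingale for the vertex-reinforced jump process: at the parent the process crosses the edge at
rate `z` while `p` grows, and at the child it crosses it at rate `p` while `z` grows. -/
structure IsEdgeMartingale (g : Bool → ℝ → ℝ → ℝ) : Prop where
  nonneg : ∀ d p z, 0 < p → 0 < z → 0 ≤ g d p z
  hasDerivAt_parent : ∀ p z, 0 < p → 0 < z →
    HasDerivAt (fun q => g false q z) (-(z * (g true p z - g false p z))) p
  hasDerivAt_child : ∀ p z, 0 < p → 0 < z →
    HasDerivAt (fun q => g true p q) (-(p * (g false p z - g true p z))) z
  exists_le : ∃ K, 0 ≤ K ∧ ∀ d p z, 1 ≤ p → 1 ≤ z → g d p z ≤ K * (1 + z) ^ 2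
  measurable : ∀ d, Measurable fun e : ℝ × ℝ => g d e.1 e.2

variable {b : ℕ}

theorem aryTree_neighborFinset_nonempty (hb : 0 < b) (x : List (Fin b)) :
    ((aryTree b).neighborFinset x).Nonempty :=
  ⟨⟨0, hb⟩ :: x, (SimpleGraph.mem_neighborFinset _ _ _).2 (Or.inl ⟨⟨0, hb⟩, rfl⟩)⟩

/-- Only the step along an edge changes the side of that edge on which the walker is. -/
theorem suffix_iff_of_adj {i : Fin b} {u x y : List (Fin b)} (hxy : (aryTree b).Adj x y)
    (h1 : ¬(x = i :: u ∧ y = u)) (h2 : ¬(x = u ∧ y = i :: u)) :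
    i :: u <:+ x ↔ i :: u <:+ y := by
  rcases hxy with ⟨j, rfl⟩ | ⟨j, rfl⟩
  · rw [List.suffix_cons_iff]
    refine ⟨Or.inr, fun h => h.resolve_left fun h => h2 ?_⟩
    obtain ⟨rfl, rfl⟩ := List.cons.inj h
    exact ⟨rfl, rfl⟩
  · rw [List.suffix_cons_iff]
    refine ⟨fun h => h.resolve_left fun h => h1 ?_, Or.inr⟩
    obtain ⟨rfl, rfl⟩ := List.cons.inj h
    exact ⟨rfl, rfl⟩

/-- The value of the function `g c` of the edge above `c`, for a walker at `x` and local
times `L`. -/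
def edgeValue (g : List (Fin b) → Bool → ℝ → ℝ → ℝ) (x : List (Fin b)) (L : List (Fin b) → ℝ)
    (c : List (Fin b)) : ℝ :=
  g c (decide (c <:+ x)) (L c.tail) (L c)

/-- The product of the functions `g c` over the edges above the vertices of `C`. -/
def edgeProduct (g : List (Fin b) → Bool → ℝ → ℝ → ℝ) (C : Finset (List (Fin b)))
    (x : List (Fin b)) (L : List (Fin b) → ℝ) : ℝ :=
  ∏ c ∈ C, edgeValue g x L c

theorem edgeProduct_nonneg {g : List (Fin b) → Bool → ℝ → ℝ → ℝ} {C : Finset (List (Fin b))}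
    (hg : ∀ c ∈ C, IsEdgeMartingale (g c)) (x : List (Fin b)) {L : List (Fin b) → ℝ}
    (hL : ∀ v, 0 < L v) : 0 ≤ edgeProduct g C x L :=
  Finset.prod_nonneg fun c hc => (hg c hc).nonneg _ _ _ (hL _) (hL _)

/-- While the walker waits at `x` and the local time of `x` grows, the derivative of an edge
function compensates its expected change at the jump. -/
theorem hasDerivAt_edgeValue {g : List (Fin b) → Bool → ℝ → ℝ → ℝ} {c : List (Fin b)}
    (hg : IsEdgeMartingale (g c)) (hc : c ≠ []) (x : List (Fin b)) {L : List (Fin b) → ℝ}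
    (hL : ∀ v, 0 < L v) {w : ℝ} (hw : 0 ≤ w) :
    HasDerivAt (fun w => edgeValue g x (Function.update L x (L x + w)) c)
      (-(∑ y ∈ (aryTree b).neighborFinset x, L y *
        (edgeValue g y (Function.update L x (L x + w)) c -
          edgeValue g x (Function.update L x (L x + w)) c))) w := by
  obtain ⟨i, u, rfl⟩ := List.exists_cons_of_ne_nil hc
  have hne : i :: u ≠ u := by simp
  have hns : ¬ i :: u <:+ u := fun h => by simpa using h.length_le
  have hadj : (aryTree b).Adj u (i :: u) := Or.inl ⟨i, rfl⟩
  have hzero : ∀ y ∈ (aryTree b).neighborFinset x, ¬(x = i :: u ∧ y = u) →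
      ¬(x = u ∧ y = i :: u) → L y *
        (edgeValue g y (Function.update L x (L x + w)) (i :: u) -
          edgeValue g x (Function.update L x (L x + w)) (i :: u)) = 0 := by
    intro y hy h1 h2
    have h := suffix_iff_of_adj (by simpa using hy) h1 h2
    simp only [edgeValue, h, sub_self, mul_zero]
  have hshift : ∀ a : ℝ, HasDerivAt (fun w : ℝ => a + w) 1 w := fun a =>
    (hasDerivAt_id w).const_add a
  by_cases h1 : x = i :: u
  · subst h1
    rw [Finset.sum_eq_single u (fun y hy hyu => hzero y hy (fun h => hyu h.2) fun h => hne h.1)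
      (fun hu => absurd (by simpa using hadj.symm) hu)]
    have hp : 0 < L (i :: u) + w := by linarith [hL (i :: u)]
    have := (hg.hasDerivAt_child (L u) (L (i :: u) + w) (hL u) hp).comp w (hshift (L (i :: u)))
    simpa [edgeValue, Function.update_of_ne hne.symm, hns, Function.comp_def] using this
  by_cases h2 : x = u
  · subst h2
    rw [Finset.sum_eq_single (i :: x) (fun y hy hyu => hzero y hy (fun h => hne h.1.symm)
      fun h => hyu h.2) (fun hu => absurd (by simpa using hadj) hu)]
    have hp : 0 < L x + w := by linarith [hL x]
    have := (hg.hasDerivAt_parent (L x + w) (L (i :: x)) hp (hL _)).comp w (hshift (L x))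
    simpa [edgeValue, Function.update_of_ne hne, hns, Function.comp_def] using this
  · rw [Finset.sum_eq_zero fun y hy => hzero y hy (fun h => h1 h.1) fun h => h2 h.1, neg_zero]
    have : (fun w => edgeValue g x (Function.update L x (L x + w)) (i :: u)) =
        fun _ => edgeValue g x L (i :: u) := by
      funext w
      simp [edgeValue, Function.update_of_ne (Ne.symm h1), Function.update_of_ne (Ne.symm h2)]
    rw [this]
    exact hasDerivAt_const _ _

/-- A jump changes at most one factor of the product, so the increment of the product is the sum
over the edges of the increments of one factor. -/
theorem edgeProduct_sub_edgeProduct (g : List (Fin b) → Bool → ℝ → ℝ → ℝ)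
    {C : Finset (List (Fin b))} (hC : [] ∉ C) {x y : List (Fin b)} (hxy : (aryTree b).Adj x y)
    (L : List (Fin b) → ℝ) :
    edgeProduct g C y L - edgeProduct g C x L =
      ∑ c ∈ C, (∏ c' ∈ C.erase c, edgeValue g x L c') *
        (edgeValue g y L c - edgeValue g x L c) := by
  obtain ⟨e, he⟩ : ∃ e, ∀ c ∈ C, c ≠ e → edgeValue g y L c = edgeValue g x L c := by
    rcases id hxy with ⟨j, hj⟩ | ⟨j, hj⟩
    · refine ⟨y, fun c hc hce => ?_⟩
      obtain ⟨i, u, rfl⟩ := List.exists_cons_of_ne_nil (ne_of_mem_of_not_mem hc hC)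
      have := suffix_iff_of_adj (i := i) (u := u) hxy
        (fun h => by have := congrArg List.length (hj.symm.trans h.2); simp [h.1] at this; omega)
        (fun h => hce h.2.symm)
      simp only [edgeValue, this]
    · refine ⟨x, fun c hc hce => ?_⟩
      obtain ⟨i, u, rfl⟩ := List.exists_cons_of_ne_nil (ne_of_mem_of_not_mem hc hC)
      have := suffix_iff_of_adj (i := i) (u := u) hxy (fun h => hce h.1.symm)
        (fun h => by have := congrArg List.length (hj.symm.trans h.1); simp [h.2] at this; omega)
      simp only [edgeValue, this]
  by_cases heC : e ∈ C
  · rw [Finset.sum_eq_single_of_mem e heC fun c hc hce => by rw [he c hc hce, sub_self, mul_zero],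
      edgeProduct, edgeProduct, ← Finset.mul_prod_erase C _ heC,
      ← Finset.mul_prod_erase C (edgeValue g x L) heC, Finset.prod_congr rfl fun c hc =>
        he c (Finset.mem_of_mem_erase hc) (Finset.ne_of_mem_erase hc)]
    ring
  · have he' : ∀ c ∈ C, edgeValue g y L c = edgeValue g x L c := fun c hc =>
      he c hc (ne_of_mem_of_not_mem hc heC)
    rw [Finset.sum_eq_zero fun c hc => by rw [he' c hc, sub_self, mul_zero], edgeProduct,
      edgeProduct, Finset.prod_congr rfl he', sub_self]

/-- A product of edge martingales is again a martingale, since no two edges of the tree are crossed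
at the same time. -/
theorem hasDerivAt_edgeProduct {g : List (Fin b) → Bool → ℝ → ℝ → ℝ} {C : Finset (List (Fin b))}
    (hg : ∀ c ∈ C, IsEdgeMartingale (g c)) (hC : [] ∉ C) (x : List (Fin b))
    {L : List (Fin b) → ℝ} (hL : ∀ v, 0 < L v) {w : ℝ} (hw : 0 ≤ w) :
    HasDerivAt (fun w => edgeProduct g C x (Function.update L x (L x + w)))
      (-(∑ y ∈ (aryTree b).neighborFinset x, L y *
        (edgeProduct g C y (Function.update L x (L x + w)) -
          edgeProduct g C x (Function.update L x (L x + w))))) w := by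
  have h := HasDerivAt.fun_finsetProd (u := C) (x := w) fun c hc =>
    hasDerivAt_edgeValue (hg c hc) (ne_of_mem_of_not_mem hc hC) x hL hw
  refine h.congr_deriv ?_
  have hsum : ∀ y ∈ (aryTree b).neighborFinset x, L y *
      (edgeProduct g C y (Function.update L x (L x + w)) -
        edgeProduct g C x (Function.update L x (L x + w))) = _ := fun y hy => by
    rw [edgeProduct_sub_edgeProduct g hC (by simpa using hy), Finset.mul_sum]
  rw [Finset.sum_congr rfl hsum, Finset.sum_comm, ← Finset.sum_neg_distrib]
  refine Finset.sum_congr rfl fun c _ => ?_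
  rw [smul_eq_mul, mul_neg, Finset.mul_sum]
  congr 1
  refine Finset.sum_congr rfl fun y _ => ?_
  ring

theorem tendsto_one_add_pow_mul_exp_neg {R : ℝ} (hR : 0 < R) (k : ℕ) :
    Filter.Tendsto (fun w : ℝ => (1 + w) ^ k * Real.exp (-(R * w))) Filter.atTop (nhds 0) := by
  have h1 : Filter.Tendsto (fun w : ℝ => R * (1 + w)) Filter.atTop Filter.atTop :=
    (Filter.tendsto_atTop_add_const_left _ 1 Filter.tendsto_id).const_mul_atTop hR
  have h2 := ((Real.tendsto_pow_mul_exp_neg_atTop_nhds_zero k).comp h1).const_mul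
    (Real.exp R / R ^ k)
  rw [mul_zero] at h2
  refine h2.congr fun w => ?_
  have : Real.exp (-(R * (1 + w))) = Real.exp (-(R * w)) / Real.exp R := by
    rw [← Real.exp_sub]
    ring_nf
  simp only [Function.comp_apply, this, mul_pow]
  field_simp

/-- Edge products grow at most polynomially during a stay at `x`. -/
theorem edgeProduct_update_le {g : List (Fin b) → Bool → ℝ → ℝ → ℝ} {C : Finset (List (Fin b))}
    (hg : ∀ c ∈ C, IsEdgeMartingale (g c)) (x : List (Fin b))
    {L : List (Fin b) → ℝ} (hL : ∀ v, 1 ≤ L v) :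
    ∃ K, ∀ w, 0 ≤ w →
      edgeProduct g C x (Function.update L x (L x + w)) ≤ K * (1 + w) ^ (2 * C.card) := by
  have h : ∀ c, ∃ K, 0 ≤ K ∧ (c ∈ C → ∀ d p z, 1 ≤ p → 1 ≤ z → g c d p z ≤ K * (1 + z) ^ 2) := by
    intro c
    by_cases hc : c ∈ C
    · obtain ⟨K, hK, hK'⟩ := (hg c hc).exists_le
      exact ⟨K, hK, fun _ => hK'⟩
    · exact ⟨0, le_rfl, fun h => absurd h hc⟩
  choose K hK0 hK using h
  refine ⟨∏ c ∈ C, K c * (1 + L c) ^ 2, fun w hw => ?_⟩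
  have hone : ∀ v, 1 ≤ Function.update L x (L x + w) v := by
    intro v
    by_cases hv : v = x
    · subst hv
      simpa using by linarith [hL v]
    · simpa [Function.update_of_ne hv] using hL v
  have hle : ∀ v, 1 + Function.update L x (L x + w) v ≤ (1 + L v) * (1 + w) := by
    intro v
    have := hL v
    by_cases hv : v = x
    · subst hv
      simp only [Function.update_self]
      nlinarith
    · rw [Function.update_of_ne hv]
      nlinarith
  rw [pow_mul, ← Finset.prod_const, ← Finset.prod_mul_distrib]
  refine Finset.prod_le_prod (fun c hc => (hg c hc).nonneg _ _ _
    (zero_lt_one.trans_le (hone _)) (zero_lt_one.trans_le (hone _))) fun c hc => ?_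
  refine (hK c hc _ _ _ (hone _) (hone _)).trans ?_
  rw [mul_assoc, ← mul_pow]
  have h0 : 0 ≤ 1 + Function.update L x (L x + w) c := by linarith [hone c]
  exact mul_le_mul_of_nonneg_left (pow_le_pow_left₀ h0 (hle c) 2) (hK0 c)

theorem measurable_edgeProduct_update {g : List (Fin b) → Bool → ℝ → ℝ → ℝ}
    {C : Finset (List (Fin b))} (hg : ∀ c ∈ C, IsEdgeMartingale (g c)) {E : Type*}
    [MeasurableSpace E] {L : List (Fin b) → E → ℝ} (hL : ∀ v, Measurable (L v))
    (x y : List (Fin b)) : Measurable fun e : E × ℝ =>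
      edgeProduct g C y (Function.update (L · e.1) x (L x e.1 + e.2)) := by
  have h : ∀ v, Measurable fun e : E × ℝ => Function.update (L · e.1) x (L x e.1 + e.2) v := by
    intro v
    by_cases hv : v = x
    · subst hv
      simpa [Function.comp_def, Pi.add_def] using ((hL v).comp measurable_fst).add measurable_snd
    · simpa [Function.update_of_ne hv, Function.comp_def] using (hL v).comp measurable_fst
  exact Finset.measurable_fun_prod _ fun c hc => ((hg c hc).measurable _).comp
    ((h c.tail).prodMk (h c))

/-- The martingale property of an edge product over one step of the process. -/
theorem sum_lintegral_edgeProduct (hb : 0 < b) {g : List (Fin b) → Bool → ℝ → ℝ → ℝ}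
    {C : Finset (List (Fin b))} (hg : ∀ c ∈ C, IsEdgeMartingale (g c)) (hC : [] ∉ C)
    (x : List (Fin b)) {L : List (Fin b) → ℝ} (hL : ∀ v, 1 ≤ L v) :
    ∑ y ∈ (aryTree b).neighborFinset x, ∫⁻ w in Ioi (0 : ℝ),
      ENNReal.ofReal (L y * Real.exp (-(exitRate (aryTree b) x L * w))) *
        ENNReal.ofReal (edgeProduct g C y (Function.update L x (L x + w))) =
      ENNReal.ofReal (edgeProduct g C x L) := by
  set R := exitRate (aryTree b) x L with hRdef
  have hL0 : ∀ v, 0 < L v := fun v => zero_lt_one.trans_le (hL v)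
  have hR : 0 < R := Finset.sum_pos (fun y _ => hL0 y) (aryTree_neighborFinset_nonempty hb x)
  have hpos : ∀ w, 0 ≤ w → ∀ v, 0 < Function.update L x (L x + w) v := by
    intro w hw v
    by_cases hv : v = x
    · subst hv
      simpa using by linarith [hL0 v]
    · simpa [Function.update_of_ne hv] using hL0 v
  have hmeas : ∀ y, Measurable fun w => edgeProduct g C y (Function.update L x (L x + w)) :=
    fun y => (measurable_edgeProduct_update hg (E := Unit) (L := fun v _ => L v)
      (fun v => measurable_const) x y).comp (measurable_const (a := ()) |>.prodMk measurable_id)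
  rw [← lintegral_finsetSum _ fun y _ => by have := hmeas y; fun_prop]
  have hF := lintegral_Ioi_of_hasDerivAt_neg (a := 0)
    (F := fun w => Real.exp (-(R * w)) * edgeProduct g C x (Function.update L x (L x + w)))
    (f := fun w => ∑ y ∈ (aryTree b).neighborFinset x, L y * Real.exp (-(R * w)) *
      edgeProduct g C y (Function.update L x (L x + w))) ?_ ?_ ?_
  · simp only [mul_zero, neg_zero, Real.exp_zero, one_mul, add_zero, Function.update_eq_self] at hF
    rw [← hF]
    refine setLIntegral_congr_fun measurableSet_Ioi fun w hw => ?_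
    have hw' : 0 ≤ w := le_of_lt hw
    rw [ENNReal.ofReal_sum_of_nonneg]
    · refine Finset.sum_congr rfl fun y _ => ?_
      rw [ENNReal.ofReal_mul (mul_nonneg (hL0 y).le (Real.exp_pos _).le)]
    · intro y _
      exact mul_nonneg (mul_nonneg (hL0 y).le (Real.exp_pos _).le)
        (edgeProduct_nonneg hg y (hpos w hw'))
  · intro w hw
    have h1 : HasDerivAt (fun w : ℝ => -(R * w)) (-(R * 1)) w :=
      ((hasDerivAt_id w).const_mul R).neg
    refine (h1.exp.mul (hasDerivAt_edgeProduct hg hC x hL0 hw)).congr_deriv ?_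
    simp only [mul_sub, Finset.sum_sub_distrib, ← Finset.sum_mul]
    rw [show ∑ y ∈ (aryTree b).neighborFinset x, L y = R from rfl]
    simp only [mul_right_comm _ (Real.exp _), ← Finset.sum_mul]
    ring
  · intro w hw
    exact Finset.sum_nonneg fun y _ => mul_nonneg (mul_nonneg (hL0 y).le (Real.exp_pos _).le)
        (edgeProduct_nonneg hg y (hpos w (le_of_lt hw)))
  · obtain ⟨K, hK⟩ := edgeProduct_update_le hg x hL
    have hlim := (tendsto_one_add_pow_mul_exp_neg hR (2 * C.card)).const_mul K
    rw [mul_zero] at hlim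
    refine squeeze_zero' ?_ ?_ hlim
    · filter_upwards [Filter.eventually_ge_atTop 0] with w hw
      exact mul_nonneg (Real.exp_pos _).le (edgeProduct_nonneg hg x (hpos w hw))
    · filter_upwards [Filter.eventually_ge_atTop 0] with w hw
      calc _ ≤ Real.exp (-(R * w)) * (K * (1 + w) ^ (2 * C.card)) :=
            mul_le_mul_of_nonneg_left (hK w hw) (Real.exp_pos _).le
        _ = _ := by ring

end EdgeMartingale

/-! ### First and second moments along paths -/

section Moments

/-- The edge martingale whose value at the parent's side is the ratio `z / p`. -/
noncomputable def firstMoment (d : Bool) (p z : ℝ) : ℝ :=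
  if d then z / p + 1 / p ^ 2 else z / p

/-- An edge martingale that dominates the square of `firstMoment`. -/
noncomputable def secondMoment (d : Bool) (p z : ℝ) : ℝ :=
  if d then z ^ 2 / p ^ 2 + 3 * z / p ^ 3 + 3 / p ^ 4 else z ^ 2 / p ^ 2 + z / p ^ 3

theorem isEdgeMartingale_firstMoment : IsEdgeMartingale firstMoment where
  nonneg d p z hp hz := by
    unfold firstMoment
    split_ifs <;> positivity
  hasDerivAt_parent p z hp hz := by
    have h := (hasDerivAt_const p z).div (hasDerivAt_id p) hp.ne'
    refine HasDerivAt.congr_deriv (f := fun q => z / q) h ?_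
    simp only [firstMoment, if_true, Bool.false_eq_true, if_false, id]
    field_simp
    ring
  hasDerivAt_child p z hp hz := by
    have h := ((hasDerivAt_id z).div_const p).add_const (1 / p ^ 2)
    refine HasDerivAt.congr_deriv (f := fun q => q / p + 1 / p ^ 2) h ?_
    simp only [firstMoment, if_true, Bool.false_eq_true, if_false]
    field_simp
    ring
  exists_le := by
    refine ⟨1, zero_le_one, fun d p z hp hz => ?_⟩
    have h1 : z / p ≤ z := div_le_self (by linarith) hp
    have h2 : 1 / p ^ 2 ≤ 1 := div_le_self zero_le_one (one_le_pow₀ hp)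
    unfold firstMoment
    split_ifs <;> nlinarith
  measurable d := by
    unfold firstMoment
    split_ifs <;> fun_prop

theorem isEdgeMartingale_secondMoment : IsEdgeMartingale secondMoment where
  nonneg d p z hp hz := by
    unfold secondMoment
    split_ifs <;> positivity
  hasDerivAt_parent p z hp hz := by
    have h1 := (hasDerivAt_const p (z ^ 2)).div ((hasDerivAt_id p).pow 2) (pow_ne_zero 2 hp.ne')
    have h2 := (hasDerivAt_const p z).div ((hasDerivAt_id p).pow 3) (pow_ne_zero 3 hp.ne')
    refine HasDerivAt.congr_deriv (f := fun q => z ^ 2 / q ^ 2 + z / q ^ 3) (h1.add h2) ?_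
    simp only [secondMoment, if_true, Bool.false_eq_true, if_false, Pi.pow_apply, id]
    field_simp
    ring
  hasDerivAt_child p z hp hz := by
    have h1 := ((hasDerivAt_id z).pow 2).div_const (p ^ 2)
    have h2 := ((hasDerivAt_id z).const_mul 3).div_const (p ^ 3)
    refine HasDerivAt.congr_deriv (f := fun q => q ^ 2 / p ^ 2 + 3 * q / p ^ 3 + 3 / p ^ 4)
      ((h1.add h2).add_const (3 / p ^ 4)) ?_
    simp only [secondMoment, if_true, Bool.false_eq_true, if_false, id]
    field_simp
    ring
  exists_le := by
    refine ⟨3, by norm_num, fun d p z hp hz => ?_⟩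
    have h1 : z ^ 2 / p ^ 2 ≤ z ^ 2 := div_le_self (by positivity) (one_le_pow₀ hp)
    have h2 : z / p ^ 3 ≤ z := div_le_self (by linarith) (one_le_pow₀ hp)
    have h3 : 3 * z / p ^ 3 ≤ 3 * z := div_le_self (by linarith) (one_le_pow₀ hp)
    have h4 : 3 / p ^ 4 ≤ 3 := div_le_self (by norm_num) (one_le_pow₀ hp)
    unfold secondMoment
    split_ifs <;> nlinarith
  measurable d := by
    unfold secondMoment
    split_ifs <;> fun_prop

theorem firstMoment_mul_self_le (d : Bool) {p z : ℝ} (hp : 0 < p) (hz : 0 < z) :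
    firstMoment d p z * firstMoment d p z ≤ secondMoment d p z := by
  unfold firstMoment secondMoment
  split_ifs
  · have : z ^ 2 / p ^ 2 + 3 * z / p ^ 3 + 3 / p ^ 4 -
        (z / p + 1 / p ^ 2) * (z / p + 1 / p ^ 2) = z / p ^ 3 + 2 / p ^ 4 := by
      field_simp
      ring
    have h : 0 ≤ z / p ^ 3 + 2 / p ^ 4 := by positivity
    linarith
  · have : z ^ 2 / p ^ 2 + z / p ^ 3 - z / p * (z / p) = z / p ^ 3 := by
      field_simp
      ring
    have h : 0 ≤ z / p ^ 3 := by positivity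
    linarith

/-- The excess of the second moment over the square of the first has relative size `1 / (p * z)`,
which is at most `1` because local times are at least `1`. -/
theorem secondMoment_false_le {p z : ℝ} (hp : 1 ≤ p) (hz : 1 ≤ z) :
    secondMoment false p z ≤ 2 * (firstMoment false p z * firstMoment false p z) := by
  have hp0 : 0 < p := by linarith
  simp only [firstMoment, secondMoment, Bool.false_eq_true, if_false]
  have : 2 * (z / p * (z / p)) - (z ^ 2 / p ^ 2 + z / p ^ 3) = z * (z * p - 1) / p ^ 3 := by
    field_simp
    ring
  have h : 0 ≤ z * (z * p - 1) / p ^ 3 := by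
    have : 0 ≤ z * p - 1 := by nlinarith
    positivity
  linarith

theorem div_le_firstMoment (d : Bool) {p z : ℝ} (hp : 0 < p) : z / p ≤ firstMoment d p z := by
  unfold firstMoment
  have : 0 ≤ 1 / p ^ 2 := by positivity
  split_ifs <;> linarith

variable {b : ℕ}

/-- The lower endpoints of the edges on the path from the root to `v`: the nonempty suffixes
of `v`. -/
def pathEdges (v : List (Fin b)) : Finset (List (Fin b)) :=
  v.tails.toFinset.erase []

theorem mem_pathEdges {c v : List (Fin b)} : c ∈ pathEdges v ↔ c ≠ [] ∧ c <:+ v := by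
  simp [pathEdges]

theorem nil_notMem_pathEdges (v : List (Fin b)) : [] ∉ pathEdges v := by
  simp [mem_pathEdges]

theorem pathEdges_nil : pathEdges ([] : List (Fin b)) = ∅ := by
  ext c
  simp [mem_pathEdges]

theorem pathEdges_cons (i : Fin b) (u : List (Fin b)) :
    pathEdges (i :: u) = insert (i :: u) (pathEdges u) := by
  ext c
  simp only [mem_pathEdges, List.suffix_cons_iff, Finset.mem_insert]
  constructor
  · tauto
  · rintro (rfl | h)
    · simp
    · tauto

theorem notMem_pathEdges_of_length_lt {c v : List (Fin b)} (h : v.length < c.length) :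
    c ∉ pathEdges v := fun hc => by
  have := (mem_pathEdges.1 hc).2.length_le
  omega

/-- The martingale started from `1` that is at least the ratio of the local times of `v` and of
the root. -/
noncomputable def pathProduct (v x : List (Fin b)) (L : List (Fin b) → ℝ) : ℝ :=
  edgeProduct (fun _ => firstMoment) (pathEdges v) x L

/-- The edge functions of `pairProduct v w`: second moments on the common part of the two paths,
first moments elsewhere. -/
noncomputable def pairMoment (v w c : List (Fin b)) : Bool → ℝ → ℝ → ℝ :=
  if c ∈ pathEdges v ∩ pathEdges w then secondMoment else firstMoment

/-- A martingale that dominates `pathProduct v * pathProduct w`. -/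
noncomputable def pairProduct (v w x : List (Fin b)) (L : List (Fin b) → ℝ) : ℝ :=
  edgeProduct (pairMoment v w) (pathEdges v ∪ pathEdges w) x L

theorem isEdgeMartingale_pairMoment (v w c : List (Fin b)) :
    IsEdgeMartingale (pairMoment v w c) := by
  unfold pairMoment
  split_ifs
  exacts [isEdgeMartingale_secondMoment, isEdgeMartingale_firstMoment]

theorem prod_pathEdges_div (v : List (Fin b)) {L : List (Fin b) → ℝ} (hL : ∀ v, 0 < L v) :
    ∏ c ∈ pathEdges v, L c / L c.tail = L v / L [] := by
  induction v with
  | nil => simp [pathEdges_nil, (hL []).ne']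
  | cons i u ih =>
    rw [pathEdges_cons, Finset.prod_insert (notMem_pathEdges_of_length_lt (by simp)), ih]
    have := hL u
    have := hL []
    rw [List.tail_cons]
    field_simp

theorem div_le_pathProduct (v x : List (Fin b)) {L : List (Fin b) → ℝ} (hL : ∀ v, 0 < L v) :
    L v / L [] ≤ pathProduct v x L := by
  rw [← prod_pathEdges_div v hL, pathProduct, edgeProduct]
  refine Finset.prod_le_prod (fun c _ => (div_pos (hL _) (hL _)).le) fun c _ => ?_
  exact div_le_firstMoment _ (hL _)

theorem pathProduct_nil (v : List (Fin b)) {L : List (Fin b) → ℝ} (hL : ∀ v, 0 < L v) :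
    pathProduct v [] L = L v / L [] := by
  rw [← prod_pathEdges_div v hL, pathProduct, edgeProduct]
  refine Finset.prod_congr rfl fun c hc => ?_
  simp [edgeValue, (mem_pathEdges.1 hc).1, firstMoment]

theorem pathProduct_nonneg (v x : List (Fin b)) {L : List (Fin b) → ℝ} (hL : ∀ v, 0 < L v) :
    0 ≤ pathProduct v x L :=
  edgeProduct_nonneg (C := pathEdges v) (fun _ _ => isEdgeMartingale_firstMoment) x hL

theorem pairProduct_nonneg (v w x : List (Fin b)) {L : List (Fin b) → ℝ} (hL : ∀ v, 0 < L v) :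
    0 ≤ pairProduct v w x L :=
  edgeProduct_nonneg (fun _ _ => isEdgeMartingale_pairMoment v w _) x hL

theorem pathProduct_mul_pathProduct (v w x : List (Fin b)) (L : List (Fin b) → ℝ) :
    pathProduct v x L * pathProduct w x L = ∏ c ∈ pathEdges v ∪ pathEdges w,
      (if c ∈ pathEdges v then edgeValue (fun _ => firstMoment) x L c else 1) *
        (if c ∈ pathEdges w then edgeValue (fun _ => firstMoment) x L c else 1) := by
  rw [Finset.prod_mul_distrib, Finset.prod_ite_mem, Finset.prod_ite_mem,
    Finset.union_inter_cancel_left, Finset.union_inter_cancel_right]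
  rfl

/-- The square of `firstMoment` is at most `secondMoment` on the common edges; elsewhere the factors
agree. -/
theorem pathProduct_mul_le (v w x : List (Fin b)) {L : List (Fin b) → ℝ} (hL : ∀ v, 0 < L v) :
    pathProduct v x L * pathProduct w x L ≤ pairProduct v w x L := by
  have h0 : ∀ c, 0 ≤ edgeValue (fun _ => firstMoment) x L c := fun c =>
    isEdgeMartingale_firstMoment.nonneg _ _ _ (hL _) (hL _)
  rw [pathProduct_mul_pathProduct]
  refine Finset.prod_le_prod (fun c _ => ?_) fun c hc => ?_
  · have := h0 c
    split_ifs <;> simp [this, mul_nonneg]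
  · by_cases h1 : c ∈ pathEdges v <;> by_cases h2 : c ∈ pathEdges w
    · simpa [h1, h2, edgeValue, pairMoment] using firstMoment_mul_self_le _ (hL _) (hL _)
    · simp [h1, h2, edgeValue, pairMoment]
    · simp [h1, h2, edgeValue, pairMoment]
    · simp [h1, h2] at hc

theorem pairProduct_nil_le (v w : List (Fin b)) {L : List (Fin b) → ℝ} (hL : ∀ v, 1 ≤ L v) :
    pairProduct v w [] L ≤
      2 ^ (pathEdges v ∩ pathEdges w).card * (L v / L [] * (L w / L [])) := by
  have hL0 : ∀ v, 0 < L v := fun v => zero_lt_one.trans_le (hL v)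
  rw [← pathProduct_nil v hL0, ← pathProduct_nil w hL0, pathProduct_mul_pathProduct,
    ← Finset.prod_const, ← Finset.inter_eq_right.2 (Finset.inter_subset_union
      (s := pathEdges v) (t := pathEdges w)), ← Finset.prod_ite_mem, ← Finset.prod_mul_distrib,
    pairProduct, edgeProduct]
  refine Finset.prod_le_prod (fun c _ => (isEdgeMartingale_pairMoment v w c).nonneg _ _ _ (hL0 _)
    (hL0 _)) fun c hc => ?_
  have hc0 : c ≠ [] := by
    rintro rfl
    simp [nil_notMem_pathEdges] at hc
  by_cases h1 : c ∈ pathEdges v <;> by_cases h2 : c ∈ pathEdges w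
  · simpa [h1, h2, edgeValue, pairMoment, hc0] using secondMoment_false_le (hL _) (hL _)
  · simp [h1, h2, edgeValue, pairMoment]
  · simp [h1, h2, edgeValue, pairMoment]
  · simp [h1, h2] at hc

/-- The words of length `n`, that is, the `n`-th level of the tree. -/
def level (b : ℕ) : ℕ → Finset (List (Fin b))
  | 0 => {[]}
  | n + 1 => (Finset.univ ×ˢ level b n).image fun e => e.1 :: e.2

theorem length_of_mem_level {n : ℕ} {v : List (Fin b)} (h : v ∈ level b n) : v.length = n := by
  induction n generalizing v with
  | zero => simpa [level] using h
  | succ n ih =>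
    obtain ⟨e, he, rfl⟩ := Finset.mem_image.1 h
    simp [ih (Finset.mem_product.1 he).2]

theorem sum_level_succ (n : ℕ) (f : List (Fin b) → ℝ) :
    ∑ v ∈ level b (n + 1), f v = ∑ u ∈ level b n, ∑ i, f (i :: u) := by
  rw [level, Finset.sum_image, Finset.sum_product_right]
  rintro ⟨i, u⟩ _ ⟨j, u'⟩ _ h
  simpa using h

theorem card_level (n : ℕ) : (level b n).card = b ^ n := by
  have h : ∑ v ∈ level b n, (1 : ℝ) = b ^ n := by
    induction n with
    | zero => simp [level]
    | succ n ih => rw [sum_level_succ, pow_succ, ← ih]; simp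
  exact_mod_cast (by simpa using h : ((level b n).card : ℝ) = b ^ n)

theorem card_pathEdges (v : List (Fin b)) : (pathEdges v).card = v.length := by
  induction v with
  | nil => simp [pathEdges_nil]
  | cons i u ih =>
    rw [pathEdges_cons, Finset.card_insert_of_notMem (notMem_pathEdges_of_length_lt (by simp)), ih,
      List.length_cons]

theorem two_pow_card_inter_cons {u u' : List (Fin b)} (h : u.length = u'.length) (i j : Fin b) :
    (2 : ℝ) ^ (pathEdges (i :: u) ∩ pathEdges (j :: u')).card =
      2 ^ (pathEdges u ∩ pathEdges u').card +
        if u = u' then (if i = j then 2 ^ u.length else 0) else 0 := by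
  have h1 : i :: u ∉ pathEdges u' := notMem_pathEdges_of_length_lt (by simp [h])
  have h2 : j :: u' ∉ pathEdges u := notMem_pathEdges_of_length_lt (by simp [h])
  by_cases he : i :: u = j :: u'
  · obtain ⟨rfl, rfl⟩ := List.cons.inj he
    rw [Finset.inter_self, Finset.inter_self, card_pathEdges, card_pathEdges]
    simp
    ring
  · have : pathEdges (i :: u) ∩ pathEdges (j :: u') = pathEdges u ∩ pathEdges u' := by
      rw [pathEdges_cons, pathEdges_cons, Finset.insert_inter_of_notMem (by simp [he, h1]),
        Finset.inter_insert_of_notMem h2]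
    rw [this]
    have h3 : ¬(u = u' ∧ i = j) := fun h => he (by rw [h.1, h.2])
    split_ifs with h4 h5
    · exact absurd ⟨h4, h5⟩ h3
    · simp
    · simp

/-- The second moment of the number of vertices in a level, weighted by the length of the common
part of two paths. It is of the order of the square of the number of vertices because `2 < 3`. -/
theorem sum_level_two_pow (n : ℕ) :
    ∑ v ∈ level 3 n, ∑ w ∈ level 3 n, (2 : ℝ) ^ (pathEdges v ∩ pathEdges w).card =
      2 * 9 ^ n - 6 ^ n := by
  induction n with
  | zero => norm_num [level, pathEdges_nil]
  | succ n ih =>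
    have hrow : ∀ u ∈ level 3 n, ∑ i : Fin 3, ∑ w ∈ level 3 (n + 1),
        (2 : ℝ) ^ (pathEdges (i :: u) ∩ pathEdges w).card =
          9 * ∑ w ∈ level 3 n, (2 : ℝ) ^ (pathEdges u ∩ pathEdges w).card + 3 * 2 ^ n := by
      intro u hu
      have hu' := length_of_mem_level hu
      have : ∀ i : Fin 3, ∑ w ∈ level 3 (n + 1),
          (2 : ℝ) ^ (pathEdges (i :: u) ∩ pathEdges w).card =
            3 * ∑ w ∈ level 3 n, (2 : ℝ) ^ (pathEdges u ∩ pathEdges w).card + 2 ^ n := by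
        intro i
        rw [sum_level_succ, Finset.sum_congr rfl fun w hw => Finset.sum_congr rfl fun j _ =>
          two_pow_card_inter_cons (hu'.trans (length_of_mem_level hw).symm) i j]
        simp only [Finset.sum_add_distrib, Finset.sum_const, Finset.card_univ, Fintype.card_fin,
          nsmul_eq_mul, ← Finset.mul_sum, hu']
        congr 1
        rw [Finset.sum_eq_single_of_mem u hu fun w _ hwu => by simp [hwu.symm]]
        simp
      rw [Finset.sum_congr rfl fun i _ => this i]
      simp
      ring
    rw [sum_level_succ, Finset.sum_congr rfl hrow, Finset.sum_add_distrib, ← Finset.mul_sum, ih,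
      Finset.sum_const, card_level]
    have : (6 : ℝ) ^ n = 3 ^ n * 2 ^ n := by rw [← mul_pow]; norm_num
    simp only [nsmul_eq_mul, Nat.cast_pow, Nat.cast_ofNat, pow_succ, this]
    ring

end Moments

/-! ### Martingales of the process, and optional stopping -/

section Survival

theorem lintegral_indicator_mul {Ω : Type*} [MeasurableSpace Ω] {μ : Measure Ω} {s : Set Ω}
    (hs : MeasurableSet s) (f g : Ω → ENNReal) :
    ∫⁻ ω, s.indicator f ω * g ω ∂μ = ∫⁻ ω in s, f ω * g ω ∂μ := by
  rw [← lintegral_indicator hs]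
  refine lintegral_congr fun ω => ?_
  by_cases h : ω ∈ s <;> simp [h]

variable {b : ℕ} {Ω : Type*}

theorem measurable_edgeProduct_history {g : List (Fin b) → Bool → ℝ → ℝ → ℝ}
    {C : Finset (List (Fin b))} (hg : ∀ c ∈ C, IsEdgeMartingale (g c)) (Y : ℕ → Ω → List (Fin b))
    (W : ℕ → Ω → ℝ≥0) (n : ℕ) :
    Measurable[history Y W n] fun ω => edgeProduct g C (Y n ω) (localTime Y W n · ω) := by
  refine Finset.measurable_fun_prod _ fun c hc => ?_
  have hval : ∀ d, Measurable[history Y W n] fun ω =>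
      g c d (localTime Y W n c.tail ω) (localTime Y W n c ω) := fun d =>
    ((hg c hc).measurable d).comp
      ((measurable_localTime Y W n c.tail).prodMk (measurable_localTime Y W n c))
  have hset : MeasurableSet[history Y W n] {ω | c <:+ Y n ω} :=
    measurable_position_history Y W le_rfl (t := {x | c <:+ x}) trivial
  have heq : (fun ω => edgeValue g (Y n ω) (localTime Y W n · ω) c) = fun ω =>
      if c <:+ Y n ω then g c true (localTime Y W n c.tail ω) (localTime Y W n c ω)
      else g c false (localTime Y W n c.tail ω) (localTime Y W n c ω) := by
    funext ω
    by_cases h : c <:+ Y n ω <;> simp [edgeValue, h]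
  rw [heq]
  exact Measurable.ite hset (hval true) (hval false)

variable [mΩ : MeasurableSpace Ω] {ρ : List (Fin b)} {P : Measure Ω}
  {X : ℝ≥0 → Ω → List (Fin b)} {Y : ℕ → Ω → List (Fin b)} {W : ℕ → Ω → ℝ≥0}

/-- Edge products are martingales along the jump chain. -/
theorem IsVRJPWith.lintegral_edgeProduct_succ [IsProbabilityMeasure P]
    (h : IsVRJPWith (aryTree b) ρ P X Y W) (hb : 0 < b)
    {g : List (Fin b) → Bool → ℝ → ℝ → ℝ} {C : Finset (List (Fin b))}
    (hg : ∀ c ∈ C, IsEdgeMartingale (g c)) (hC : [] ∉ C) (n : ℕ) {u : Ω → ENNReal}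
    (hu : Measurable[history Y W n] u) :
    ∫⁻ ω, u ω * ENNReal.ofReal (edgeProduct g C (Y (n + 1) ω) (localTime Y W (n + 1) · ω)) ∂P =
      ∫⁻ ω, u ω * ENNReal.ofReal (edgeProduct g C (Y n ω) (localTime Y W n · ω)) ∂P := by
  have hstep := h.lintegral_step (aryTree_neighborFinset_nonempty hb) n
    (H := fun x y ω w => u ω * ENNReal.ofReal
      (edgeProduct g C y (Function.update (localTime Y W n · ω) x (localTime Y W n x ω + w)))) ?_
  · simp only [localTime_succ_eq_update]
    rw [hstep]
    refine lintegral_congr fun ω => ?_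
    rw [← sum_lintegral_edgeProduct hb hg hC (Y n ω) fun v => one_le_localTime Y W n v ω,
      Finset.mul_sum]
    refine Finset.sum_congr rfl fun y _ => ?_
    rw [← lintegral_const_mul]
    · refine lintegral_congr fun w => ?_
      ring
    · have := (measurable_edgeProduct_update hg (E := Unit) (L := fun v _ => localTime Y W n v ω)
        (fun v => measurable_const) (Y n ω) y).comp
        (measurable_const (a := ()) |>.prodMk measurable_id)
      simp only [Function.comp_def, id] at this
      fun_prop
  · intro x y
    refine Measurable.mul (hu.comp (@measurable_fst Ω ℝ (history Y W n) Real.measurableSpace)) ?_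
    exact (@measurable_edgeProduct_update b g C hg Ω (history Y W n) (localTime Y W n)
      (fun v => measurable_localTime Y W n v) x y).ennreal_ofReal

/-- Scaled finite sums of edge products keep their mean over any number of steps, also when weighted
by a function of the past. -/
theorem IsVRJPWith.lintegral_sum_edgeProduct_add [IsProbabilityMeasure P]
    (h : IsVRJPWith (aryTree b) ρ P X Y W) (hb : 0 < b) {ι : Type*} (s : Finset ι) (a : ℝ)
    {g : ι → List (Fin b) → Bool → ℝ → ℝ → ℝ} {C : ι → Finset (List (Fin b))}
    (hg : ∀ i, ∀ c ∈ C i, IsEdgeMartingale (g i c)) (hC : ∀ i, [] ∉ C i) (n m : ℕ)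
    {u : Ω → ENNReal} (hu : Measurable[history Y W n] u) :
    ∫⁻ ω, u ω * ENNReal.ofReal ((∑ i ∈ s, edgeProduct (g i) (C i) (Y (n + m) ω)
      (localTime Y W (n + m) · ω)) / a) ∂P =
      ∫⁻ ω, u ω * ENNReal.ofReal ((∑ i ∈ s, edgeProduct (g i) (C i) (Y n ω)
        (localTime Y W n · ω)) / a) ∂P := by
  have key : ∀ k, n ≤ k → ∫⁻ ω, u ω * ENNReal.ofReal ((∑ i ∈ s, edgeProduct (g i) (C i) (Y k ω)
      (localTime Y W k · ω)) / a) ∂P = ∑ i ∈ s, (∫⁻ ω, u ω * ENNReal.ofReal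
        (edgeProduct (g i) (C i) (Y k ω) (localTime Y W k · ω)) ∂P) * ENNReal.ofReal a⁻¹ := by
    intro k hk
    have hmeas : ∀ i, Measurable fun ω => u ω * ENNReal.ofReal
        (edgeProduct (g i) (C i) (Y k ω) (localTime Y W k · ω)) := fun i =>
      (hu.mono (h.history_le n) le_rfl).mul
        ((measurable_edgeProduct_history (hg i) Y W k).mono (h.history_le k) le_rfl).ennreal_ofReal
    rw [← Finset.sum_mul, ← lintegral_finsetSum _ fun i _ => hmeas i, ← lintegral_mul_const _
      (Finset.measurable_fun_sum _ fun i _ => hmeas i)]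
    refine lintegral_congr fun ω => ?_
    have h0 : ∀ i ∈ s, 0 ≤ edgeProduct (g i) (C i) (Y k ω) (localTime Y W k · ω) := fun i _ =>
      edgeProduct_nonneg (hg i) _ fun v => localTime_pos Y W k v ω
    rw [div_eq_mul_inv, ENNReal.ofReal_mul (Finset.sum_nonneg h0),
      ENNReal.ofReal_sum_of_nonneg h0, ← mul_assoc, Finset.mul_sum]
  induction m with
  | zero => rfl
  | succ m ih =>
    rw [← ih, key _ (by omega), key _ (by omega)]
    refine Finset.sum_congr rfl fun i _ => ?_
    rw [← add_assoc, h.lintegral_edgeProduct_succ hb (hg i) (hC i) (n + m)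
      (hu.mono (history_mono Y W (by omega)) le_rfl)]

/-- Optional stopping, for a process that is at most `β` when it leaves the decreasing events
`C i`. -/
theorem lintegral_le_add_of_stopping {Φ : ℕ → Ω → ENNReal} {β : Ω → ENNReal} {C : ℕ → Set Ω}
    (hCm : ∀ i, MeasurableSet (C i)) (hC : Antitone C) (K : ℕ)
    (hΦ : ∀ i < K, ∫⁻ ω in C i, Φ i ω ∂P ≤ ∫⁻ ω in C i, Φ (i + 1) ω ∂P)
    (hβ : ∀ i < K, ∀ᵐ ω ∂P, ω ∈ C i \ C (i + 1) → Φ (i + 1) ω ≤ β ω) :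
    ∫⁻ ω in C 0, Φ 0 ω ∂P ≤ ∫⁻ ω in C 0 \ C K, β ω ∂P + ∫⁻ ω in C K, Φ K ω ∂P := by
  induction K with
  | zero => simp
  | succ K ih =>
    refine (ih (fun i hi => hΦ i (by omega)) fun i hi => hβ i (by omega)).trans ?_
    have h1 : ∫⁻ ω in C K, Φ (K + 1) ω ∂P ≤
        ∫⁻ ω in C K \ C (K + 1), β ω ∂P + ∫⁻ ω in C (K + 1), Φ (K + 1) ω ∂P := by
      rw [← lintegral_inter_add_sdiff _ (C K) (hCm (K + 1)),
        inter_eq_self_of_subset_right (hC K.le_succ), add_comm]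
      refine add_le_add (lintegral_mono_ae ((ae_restrict_iff' ((hCm K).diff (hCm (K + 1)))).2
        (hβ K K.lt_succ_self))) le_rfl
    have h2 : ∫⁻ ω in C 0 \ C (K + 1), β ω ∂P =
        ∫⁻ ω in C 0 \ C K, β ω ∂P + ∫⁻ ω in C K \ C (K + 1), β ω ∂P := by
      rw [← lintegral_union ((hCm K).diff (hCm (K + 1)))]
      · congr 2
        ext ω
        have h3 : ω ∈ C (K + 1) → ω ∈ C K := fun h => hC K.le_succ h
        have h4 : ω ∈ C K → ω ∈ C 0 := fun h => hC K.zero_le h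
        simp only [mem_sdiff, mem_union] at *
        tauto
      · exact disjoint_left.2 fun ω h3 h4 => h3.2 h4.1
    rw [h2, add_assoc]
    exact add_le_add le_rfl ((hΦ K K.lt_succ_self).trans h1)

theorem IsVRJPWith.ae_length_le [IsProbabilityMeasure P]
    (h : IsVRJPWith (aryTree b) [] P X Y W) (hb : 0 < b) :
    ∀ᵐ ω ∂P, ∀ n, (Y n ω).length ≤ n := by
  have hadj := ae_all_iff.2 fun n => h.ae_adj (aryTree_neighborFinset_nonempty hb) n
  filter_upwards [h.start, hadj] with ω h0 h1 n
  induction n with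
  | zero => simp [h0]
  | succ n ih =>
    rcases (h1 n).1 with ⟨i, hi⟩ | ⟨i, hi⟩
    · simpa [hi] using ih
    · have := congrArg List.length hi
      simp only [List.length_cons] at this
      omega

/-- A vertex of the `n`-th level is not reached before the `n`-th jump. -/
theorem IsVRJPWith.ae_localTime_eq_one [IsProbabilityMeasure P]
    (h : IsVRJPWith (aryTree b) [] P X Y W) (hb : 0 < b) :
    ∀ᵐ ω ∂P, ∀ n k, k ≤ n → ∀ v ∈ level b n, localTime Y W k v ω = 1 := by
  filter_upwards [h.ae_length_le hb] with ω hω n k hk v hv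
  refine localTime_eq_one fun j hj hjv => ?_
  have := hω j
  rw [hjv, length_of_mem_level hv] at this
  omega

end Survival

/-! ### The second-moment bound on the ternary tree -/

section Ternary

/-- The mean of `pathProduct` over the `n`-th level of the ternary tree. -/
noncomputable def levelMean (n : ℕ) (x : List (Fin 3)) (L : List (Fin 3) → ℝ) : ℝ :=
  (∑ v ∈ level 3 n, pathProduct v x L) / 3 ^ n

/-- The mean of `pairProduct` over the pairs of vertices of the `n`-th level. -/
noncomputable def pairMean (n : ℕ) (x : List (Fin 3)) (L : List (Fin 3) → ℝ) : ℝ :=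
  (∑ e ∈ level 3 n ×ˢ level 3 n, pairProduct e.1 e.2 x L) / 9 ^ n

theorem pairMean_nonneg (n : ℕ) (x : List (Fin 3)) {L : List (Fin 3) → ℝ} (hL : ∀ v, 0 < L v) :
    0 ≤ pairMean n x L :=
  div_nonneg (Finset.sum_nonneg fun e _ => pairProduct_nonneg e.1 e.2 x hL) (by positivity)

theorem levelMean_sq_le (n : ℕ) (x : List (Fin 3)) {L : List (Fin 3) → ℝ} (hL : ∀ v, 0 < L v) :
    levelMean n x L ^ 2 ≤ pairMean n x L := by
  rw [levelMean, pairMean, div_pow, ← pow_mul, mul_comm n 2, pow_mul, sq, Finset.sum_mul_sum,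
    ← Finset.sum_product']
  norm_num only
  refine div_le_div_of_nonneg_right (Finset.sum_le_sum fun e _ => ?_) (by positivity)
  exact pathProduct_mul_le e.1 e.2 x hL

/-- At the root, the mean over a level that has not been reached depends on the local time of the
root only. -/
theorem levelMean_nil {n : ℕ} {L : List (Fin 3) → ℝ} (hL : ∀ v, 0 < L v)
    (h1 : ∀ v ∈ level 3 n, L v = 1) : levelMean n [] L = 1 / L [] := by
  rw [levelMean, Finset.sum_congr rfl fun v hv => by rw [pathProduct_nil v hL, h1 v hv],
    Finset.sum_const, card_level]
  simp

theorem pairMean_nil_le {n : ℕ} {L : List (Fin 3) → ℝ} (hL : ∀ v, 1 ≤ L v)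
    (h1 : ∀ v ∈ level 3 n, L v = 1) : pairMean n [] L ≤ 2 * (1 / L []) ^ 2 := by
  have h2 : ∑ e ∈ level 3 n ×ˢ level 3 n, pairProduct e.1 e.2 [] L ≤
      (2 * 9 ^ n - 6 ^ n) * (1 / L []) ^ 2 := by
    rw [← sum_level_two_pow, ← Finset.sum_product', Finset.sum_mul]
    refine Finset.sum_le_sum fun e he => ?_
    have he' := Finset.mem_product.1 he
    have := pairProduct_nil_le e.1 e.2 hL
    rwa [h1 _ he'.1, h1 _ he'.2, ← sq] at this
  have h3 : (0 : ℝ) < 9 ^ n := by positivity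
  rw [pairMean, div_le_iff₀ h3]
  refine h2.trans ?_
  have h4 : (0 : ℝ) ≤ 6 ^ n := by positivity
  nlinarith [sq_nonneg (1 / L []), mul_nonneg h4 (sq_nonneg (1 / L []))]

variable {Ω : Type*} [mΩ : MeasurableSpace Ω] {P : Measure Ω} [IsProbabilityMeasure P]
  {X : ℝ≥0 → Ω → List (Fin 3)} {Y : ℕ → Ω → List (Fin 3)} {W : ℕ → Ω → ℝ≥0}

theorem IsVRJPWith.lintegral_levelMean_add (h : IsVRJPWith (aryTree 3) [] P X Y W) (N n m : ℕ)
    {u : Ω → ENNReal} (hu : Measurable[history Y W n] u) :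
    ∫⁻ ω, u ω * ENNReal.ofReal (levelMean N (Y (n + m) ω) (localTime Y W (n + m) · ω)) ∂P =
      ∫⁻ ω, u ω * ENNReal.ofReal (levelMean N (Y n ω) (localTime Y W n · ω)) ∂P :=
  h.lintegral_sum_edgeProduct_add (by norm_num) (level 3 N) (3 ^ N)
    (g := fun _ _ => firstMoment) (C := pathEdges) (fun _ _ _ => isEdgeMartingale_firstMoment)
    (fun v => nil_notMem_pathEdges v) n m hu

theorem IsVRJPWith.lintegral_pairMean_add (h : IsVRJPWith (aryTree 3) [] P X Y W) (N n m : ℕ)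
    {u : Ω → ENNReal} (hu : Measurable[history Y W n] u) :
    ∫⁻ ω, u ω * ENNReal.ofReal (pairMean N (Y (n + m) ω) (localTime Y W (n + m) · ω)) ∂P =
      ∫⁻ ω, u ω * ENNReal.ofReal (pairMean N (Y n ω) (localTime Y W n · ω)) ∂P :=
  h.lintegral_sum_edgeProduct_add (by norm_num) (level 3 N ×ˢ level 3 N) (9 ^ N)
    (g := fun e => pairMoment e.1 e.2) (C := fun e => pathEdges e.1 ∪ pathEdges e.2)
    (fun e c _ => isEdgeMartingale_pairMoment e.1 e.2 c)
    (fun e => by simp [nil_notMem_pathEdges]) n m hu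

/-- The finite-horizon form of `IsVRJPWith.measure_le_of_stopping`. -/
theorem IsVRJPWith.measure_le_of_stopping_nat (h : IsVRJPWith (aryTree 3) [] P X Y W) {k : ℕ}
    {C : ℕ → Set Ω} (hCm : ∀ i, MeasurableSet[history Y W (k + i)] (C i)) (hC : Antitone C)
    (hroot : ∀ ω ∈ C 0, Y k ω = []) {β : Ω → ENNReal}
    (hβ : ∀ i, ∀ ω ∈ C i \ C (i + 1), Y (k + i + 1) ω = [] ∧
      ENNReal.ofReal (localTime Y W k [] ω / localTime Y W (k + i + 1) [] ω) ≤ β ω)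
    {a : ℝ} (ha : 0 < a) (K : ℕ) :
    P (C 0) ≤ ∫⁻ ω in C 0, β ω ∂P + ENNReal.ofReal (2 * a) * P (C 0) +
      ENNReal.ofReal (1 / (4 * a)) * P (C K) := by
  have hCm' : ∀ i, MeasurableSet (C i) := fun i => h.history_le _ _ (hCm i)
  have hLk := measurable_localTime Y W k []
  have hone := h.ae_localTime_eq_one (by norm_num)
  -- The level `N` is not reached before the jump `k + K`.
  set N := k + K with hN
  set Φ : ℕ → Ω → ENNReal := fun i ω => ENNReal.ofReal (localTime Y W k [] ω) *
    ENNReal.ofReal (levelMean N (Y (k + i) ω) (localTime Y W (k + i) · ω)) with hΦ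
  have hpos : ∀ j v ω, 0 < localTime Y W j v ω := fun j v ω => localTime_pos Y W j v ω
  have hopt := lintegral_le_add_of_stopping (P := P) (Φ := Φ) (β := β) hCm' hC K ?_ ?_
  · have hΦ0 : ∫⁻ ω in C 0, Φ 0 ω ∂P = P (C 0) := by
      rw [← setLIntegral_one]
      refine lintegral_congr_ae ((ae_restrict_iff' (hCm' 0)).2 ?_)
      filter_upwards [hone] with ω hω hω0
      simp only [hΦ, add_zero, hroot ω hω0]
      rw [levelMean_nil (fun v => hpos k v ω) (hω N k (by omega)),
        ← ENNReal.ofReal_mul (hpos _ _ _).le, mul_one_div_cancel (hpos _ _ _).ne',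
        ENNReal.ofReal_one]
    have hpair : ∫⁻ ω in C K, ENNReal.ofReal (localTime Y W k [] ω ^ 2) *
        ENNReal.ofReal (pairMean N (Y (k + K) ω) (localTime Y W (k + K) · ω)) ∂P ≤
          ENNReal.ofReal 2 * P (C 0) := by
      refine (lintegral_mono_set (hC K.zero_le)).trans ?_
      have hmart := h.lintegral_pairMean_add N k K
        (u := (C 0).indicator fun ω => ENNReal.ofReal (localTime Y W k [] ω ^ 2))
        (Measurable.indicator (hLk.pow_const 2).ennreal_ofReal (hCm 0))
      rw [lintegral_indicator_mul (hCm' 0), lintegral_indicator_mul (hCm' 0)] at hmart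
      rw [hmart, ← setLIntegral_const]
      refine lintegral_mono_ae ((ae_restrict_iff' (hCm' 0)).2 ?_)
      filter_upwards [hone] with ω hω hω0
      rw [hroot ω hω0, ← ENNReal.ofReal_mul (by positivity)]
      refine ENNReal.ofReal_le_ofReal ?_
      refine (mul_le_mul_of_nonneg_left (pairMean_nil_le (fun v => one_le_localTime Y W k v ω)
        (hω N k (by omega))) (sq_nonneg _)).trans ?_
      have := hpos k [] ω
      field_simp
      exact le_rfl
    have hlast : ∫⁻ ω in C K, Φ K ω ∂P ≤ ENNReal.ofReal (2 * a) * P (C 0) +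
        ENNReal.ofReal (1 / (4 * a)) * P (C K) := by
      calc ∫⁻ ω in C K, Φ K ω ∂P ≤ ∫⁻ ω in C K, (ENNReal.ofReal a *
            (ENNReal.ofReal (localTime Y W k [] ω ^ 2) *
              ENNReal.ofReal (pairMean N (Y (k + K) ω) (localTime Y W (k + K) · ω))) +
                ENNReal.ofReal (1 / (4 * a))) ∂P := by
            refine lintegral_mono fun ω => ?_
            have h1 := levelMean_sq_le N (Y (k + K) ω) fun v => hpos (k + K) v ω
            have h2 := pairMean_nonneg N (Y (k + K) ω) fun v => hpos (k + K) v ω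
            simp only [hΦ]
            rw [← ENNReal.ofReal_mul (hpos _ _ _).le, ← ENNReal.ofReal_mul (sq_nonneg _),
              ← ENNReal.ofReal_mul ha.le, ← ENNReal.ofReal_add (by positivity) (by positivity)]
            refine ENNReal.ofReal_le_ofReal ?_
            set l := localTime Y W k [] ω
            set m := levelMean N (Y (k + K) ω) (localTime Y W (k + K) · ω)
            -- The inequality of arithmetic and geometric means replaces that of Cauchy–Schwarz.
            have h3 : l * m ≤ a * (l ^ 2 * m ^ 2) + 1 / (4 * a) := by
              have : a * (l ^ 2 * m ^ 2) + 1 / (4 * a) - l * m =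
                  a * (l * m - 1 / (2 * a)) ^ 2 := by
                field_simp
                ring
              have h4 : 0 ≤ a * (l * m - 1 / (2 * a)) ^ 2 := by positivity
              linarith
            refine h3.trans ?_
            gcongr
        _ = ENNReal.ofReal a * ∫⁻ ω in C K, ENNReal.ofReal (localTime Y W k [] ω ^ 2) *
              ENNReal.ofReal (pairMean N (Y (k + K) ω) (localTime Y W (k + K) · ω)) ∂P +
                ENNReal.ofReal (1 / (4 * a)) * P (C K) := by
            rw [lintegral_add_right _ measurable_const, lintegral_const_mul' _ _
              ENNReal.ofReal_ne_top, setLIntegral_const]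
        _ ≤ ENNReal.ofReal a * (ENNReal.ofReal 2 * P (C 0)) +
              ENNReal.ofReal (1 / (4 * a)) * P (C K) := by gcongr
        _ = _ := by
            rw [← mul_assoc, ← ENNReal.ofReal_mul ha.le, mul_comm a 2]
    rw [hΦ0] at hopt
    refine hopt.trans ?_
    rw [add_assoc]
    exact add_le_add (lintegral_mono_set sdiff_subset) hlast
  · intro i _
    have hmart := h.lintegral_levelMean_add N (k + i) 1
      (u := (C i).indicator fun ω => ENNReal.ofReal (localTime Y W k [] ω))
      (Measurable.indicator
        (hLk.mono (history_mono Y W (by omega)) le_rfl).ennreal_ofReal (hCm i))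
    rw [lintegral_indicator_mul (hCm' i), lintegral_indicator_mul (hCm' i)] at hmart
    exact hmart.ge
  · intro i hi
    filter_upwards [hone] with ω hω hωC
    obtain ⟨h1, h2⟩ := hβ i ω hωC
    refine le_trans (le_of_eq ?_) h2
    simp only [hΦ, ← add_assoc, h1]
    rw [levelMean_nil (fun v => hpos _ v ω) (hω N (k + i + 1) (by omega)),
      ← ENNReal.ofReal_mul (hpos _ _ _).le, mul_one_div]

/-- The second-moment bound: while the process does not leave the events `C i`, the martingale
`levelMean` is bounded in `L²`, so it cannot have lost its mass through returns to the root unless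
staying in all the events `C i` has positive probability. -/
theorem IsVRJPWith.measure_le_of_stopping (h : IsVRJPWith (aryTree 3) [] P X Y W) {k : ℕ}
    {C : ℕ → Set Ω} (hCm : ∀ i, MeasurableSet[history Y W (k + i)] (C i)) (hC : Antitone C)
    (hroot : ∀ ω ∈ C 0, Y k ω = []) {β : Ω → ENNReal}
    (hβ : ∀ i, ∀ ω ∈ C i \ C (i + 1), Y (k + i + 1) ω = [] ∧
      ENNReal.ofReal (localTime Y W k [] ω / localTime Y W (k + i + 1) [] ω) ≤ β ω)
    {a : ℝ} (ha : 0 < a) :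
    P (C 0) ≤ ∫⁻ ω in C 0, β ω ∂P + ENNReal.ofReal (2 * a) * P (C 0) +
      ENNReal.ofReal (1 / (4 * a)) * P (⋂ i, C i) := by
  have hlim : Filter.Tendsto (fun K => P (C K)) Filter.atTop (nhds (P (⋂ i, C i))) :=
    tendsto_measure_iInter_atTop (fun i => (h.history_le _ _ (hCm i)).nullMeasurableSet) hC
      ⟨0, measure_ne_top _ _⟩
  refine ge_of_tendsto' ((ENNReal.Tendsto.const_mul hlim
    (Or.inr ENNReal.ofReal_ne_top)).const_add _) fun K => ?_
  exact h.measure_le_of_stopping_nat hCm hC hroot hβ ha K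

end Ternary

/-! ### The local time of the root is bounded -/

section Transience

variable {Ω : Type*} [mΩ : MeasurableSpace Ω] {P : Measure Ω} [IsProbabilityMeasure P]
  {X : ℝ≥0 → Ω → List (Fin 3)} {Y : ℕ → Ω → List (Fin 3)} {W : ℕ → Ω → ℝ≥0}

/-- With positive probability the jump chain never returns to the root. -/
theorem IsVRJPWith.measure_no_return_pos (h : IsVRJPWith (aryTree 3) [] P X Y W) :
    0 < P {ω | Y 0 ω = [] ∧ ∀ j, Y (j + 1) ω ≠ []} := by
  set C : ℕ → Set Ω := fun i => {ω | Y 0 ω = [] ∧ ∀ j < i, Y (j + 1) ω ≠ []} with hC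
  have hCm : ∀ i, MeasurableSet[history Y W (0 + i)] (C i) := by
    intro i
    have h1 : C i = {ω | Y 0 ω = []} ∩ ⋂ j, ⋂ _ : j < i, {ω | Y (j + 1) ω = []}ᶜ := by
      ext ω
      simp [hC]
    rw [h1]
    exact MeasurableSet.inter (measurableSet_position_eq Y W (Nat.zero_le _) _)
      (MeasurableSet.iInter fun j => MeasurableSet.iInter fun hj =>
        (measurableSet_position_eq Y W (by omega) _).compl)
  have hanti : Antitone C := fun i j hij ω hω => ⟨hω.1, fun l hl => hω.2 l (hl.trans_le hij)⟩
  have hC0 : P (C 0) = 1 := by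
    rw [prob_compl_eq_zero_iff₀ (h.history_le _ _ (hCm 0)).nullMeasurableSet |>.symm]
    refine measure_mono_null ?_ (ae_iff.1 h.start)
    intro ω hω
    simpa [hC] using hω
  -- After the first stay the local time of the root is at least `1 + W 0`, so that at a return the
  -- martingale is at most `β`, whose mean is less than its initial value `1`.
  set β : Ω → ENNReal := fun ω => ENNReal.ofReal (1 / (1 + W 0 ω)) with hβdef
  have hβm : Measurable β := by
    have := (h.measurable_holding 0).coe_nnreal_real
    fun_prop
  have hβ1 : ∫⁻ ω, β ω ∂P < 1 := by
    have h1 : ∀ᵐ ω ∂P, β ω < 1 := by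
      filter_upwards [h.ae_adj (aryTree_neighborFinset_nonempty (by norm_num)) 0] with ω hω
      have hW : (0 : ℝ) < W 0 ω := hω.2
      rw [hβdef, ← ENNReal.ofReal_one]
      refine (ENNReal.ofReal_lt_ofReal_iff zero_lt_one).2 ?_
      rw [div_lt_one (by linarith)]
      linarith
    have hle : ∫⁻ ω, β ω ∂P ≤ ∫⁻ _, 1 ∂P := lintegral_mono_ae (h1.mono fun ω hω => hω.le)
    have hfin : ∫⁻ ω, β ω ∂P ≠ ⊤ := ne_top_of_le_ne_top (by simp) hle
    have := lintegral_strict_mono (IsProbabilityMeasure.ne_zero P) aemeasurable_const hfin h1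
    simpa using this
  have hinter : ⋂ i, C i = {ω | Y 0 ω = [] ∧ ∀ j, Y (j + 1) ω ≠ []} := by
    ext ω
    simp only [hC, mem_iInter, mem_ofPred_eq]
    exact ⟨fun h => ⟨(h 0).1, fun j => (h (j + 1)).2 j j.lt_succ_self⟩,
      fun h i => ⟨h.1, fun j _ => h.2 j⟩⟩
  rw [← hinter, pos_iff_ne_zero]
  intro hzero
  have hBtop : ∫⁻ ω, β ω ∂P ≠ ⊤ := (hβ1.trans ENNReal.one_lt_top).ne
  set B := (∫⁻ ω, β ω ∂P).toReal with hB
  have hBlt : B < 1 := by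
    rw [hB, ← ENNReal.toReal_one]
    exact (ENNReal.toReal_lt_toReal hBtop ENNReal.one_ne_top).2 hβ1
  have hB0 : 0 ≤ B := ENNReal.toReal_nonneg
  have key := h.measure_le_of_stopping hCm hanti (fun ω hω => hω.1) (β := β) ?_
    (a := (1 - B) / 4) (by linarith)
  · rw [hzero, hC0, mul_zero, add_zero, mul_one] at key
    have h2 : (1 : ENNReal) ≤ ENNReal.ofReal (B + 2 * ((1 - B) / 4)) := by
      rw [ENNReal.ofReal_add hB0 (by linarith), hB, ENNReal.ofReal_toReal hBtop]
      exact key.trans (add_le_add (setLIntegral_le_lintegral _ _) le_rfl)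
    rw [ENNReal.one_le_ofReal] at h2
    linarith
  · intro i ω hω
    simp only [hC, mem_sdiff, mem_ofPred_eq, not_and, not_forall, not_not] at hω
    obtain ⟨⟨h0, hi⟩, h1⟩ := hω
    obtain ⟨j, hj, hj0⟩ := h1 h0
    have hji : j = i := by
      by_contra hne
      exact hi j (by omega) hj0
    subst hji
    refine ⟨by simpa using hj0, ENNReal.ofReal_le_ofReal ?_⟩
    rw [localTime_zero]
    have h2 : localTime Y W 1 [] ω = 1 + W 0 ω := by simp [localTime, h0]
    have h3 : localTime Y W 1 [] ω ≤ localTime Y W (0 + j + 1) [] ω :=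
      localTime_mono Y W [] ω (by omega)
    rw [h2] at h3
    exact one_div_le_one_div_of_le (by positivity) h3

/-- From any visit to the root, the probability that the local time of the root does not even
double afterwards is bounded below. -/
theorem IsVRJPWith.measure_le_eight_mul (h : IsVRJPWith (aryTree 3) [] P X Y W) {k : ℕ}
    {A : Set Ω} (hA : MeasurableSet[history Y W k] A) (hroot : ∀ ω ∈ A, Y k ω = []) :
    P A ≤ 8 * P (A \ {ω | ∀ r : ℕ, ∃ j, Y j ω = [] ∧ (r : ℝ) ≤ localTime Y W j [] ω}) := by
  set D : ℕ → Set Ω := fun j =>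
    {ω | Y (k + j + 1) ω = []} ∩ {ω | 2 * localTime Y W k [] ω ≤ localTime Y W (k + j + 1) [] ω}
    with hD
  set C : ℕ → Set Ω := fun i => A ∩ ⋂ j, ⋂ _ : j < i, (D j)ᶜ with hC
  have hDm : ∀ i j, j < i → MeasurableSet[history Y W (k + i)] (D j) := by
    intro i j hj
    refine MeasurableSet.inter (measurableSet_position_eq Y W (by omega) _) ?_
    exact measurableSet_le
      (((measurable_localTime Y W k []).const_mul 2).mono (history_mono Y W (by omega)) le_rfl)
      ((measurable_localTime Y W (k + j + 1) []).mono (history_mono Y W (by omega)) le_rfl)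
  have hCm : ∀ i, MeasurableSet[history Y W (k + i)] (C i) := fun i =>
    MeasurableSet.inter (history_mono Y W (Nat.le_add_right k i) _ hA)
      (MeasurableSet.iInter fun j => MeasurableSet.iInter fun hj => (hDm i j hj).compl)
  have hanti : Antitone C := by
    intro i j hij
    refine inter_subset_inter_right _ fun ω hω => ?_
    simp only [mem_iInter] at hω ⊢
    exact fun l hl => hω l (hl.trans_le hij)
  have hC0 : C 0 = A := by simp [hC]
  have key := h.measure_le_of_stopping hCm hanti (fun ω hω => hroot ω hω.1)
    (β := fun _ => ENNReal.ofReal (1 / 2)) ?_ (a := 1 / 8) (by norm_num)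
  · rw [hC0, setLIntegral_const] at key
    have hsub : ⋂ i, C i ⊆
        A \ {ω | ∀ r : ℕ, ∃ j, Y j ω = [] ∧ (r : ℝ) ≤ localTime Y W j [] ω} := by
      intro ω hω
      have hω' : ∀ i, ω ∈ C i := mem_iInter.1 hω
      refine ⟨(hω' 0).1, fun hE => ?_⟩
      obtain ⟨r, hr⟩ := exists_nat_ge (2 * localTime Y W k [] ω)
      obtain ⟨j, hj, hjr⟩ := hE r
      have hpos := localTime_pos Y W k [] ω
      have hkj : k < j := by
        by_contra hle
        have := localTime_mono Y W [] ω (not_lt.1 hle)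
        simp only at this
        linarith
      obtain ⟨i, rfl⟩ := Nat.exists_eq_add_of_lt hkj
      have := (hω' (i + 1)).2
      simp only [mem_iInter] at this
      exact this i i.lt_succ_self ⟨hj, hr.trans hjr⟩
    refine le_trans ?_ (mul_le_mul_right (measure_mono hsub) 8)
    have hfin : ∀ s, P s ≠ ⊤ := fun s => measure_ne_top P s
    rw [← ENNReal.ofReal_toReal (hfin A), ← ENNReal.ofReal_toReal (hfin (⋂ i, C i))] at key ⊢
    set p := (P A).toReal
    set q := (P (⋂ i, C i)).toReal
    have hp : 0 ≤ p := ENNReal.toReal_nonneg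
    have hq : 0 ≤ q := ENNReal.toReal_nonneg
    rw [← ENNReal.ofReal_mul (by norm_num), ← ENNReal.ofReal_mul (by norm_num),
      ← ENNReal.ofReal_mul (by norm_num), ← ENNReal.ofReal_add (by positivity) (by positivity),
      ← ENNReal.ofReal_add (by positivity) (by positivity),
      ENNReal.ofReal_le_ofReal_iff (by positivity)] at key
    rw [show (8 : ENNReal) = ENNReal.ofReal 8 by simp, ← ENNReal.ofReal_mul (by norm_num)]
    refine ENNReal.ofReal_le_ofReal ?_
    linarith
  · intro i ω hω
    have h1 : ω ∈ D i := by
      by_contra hne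
      refine hω.2 ⟨hω.1.1, ?_⟩
      simp only [mem_iInter]
      intro j hj
      rcases Nat.lt_succ_iff_lt_or_eq.1 hj with hj | rfl
      · exact (mem_iInter₂.1 hω.1.2) j hj
      · exact hne
    refine ⟨h1.1, ENNReal.ofReal_le_ofReal ?_⟩
    have h2 : 2 * localTime Y W k [] ω ≤ localTime Y W (k + i + 1) [] ω := h1.2
    rw [div_le_div_iff₀ (localTime_pos _ _ _ _ _) two_pos]
    linarith

/-- By the previous bound, the local time of the root is not unbounded along the visits to
the root. -/
theorem IsVRJPWith.ae_exists_forall_lt (h : IsVRJPWith (aryTree 3) [] P X Y W) :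
    ∀ᵐ ω ∂P, ∃ r : ℕ, ∀ j, Y j ω = [] → localTime Y W j [] ω < r := by
  set D : ℕ → ℕ → Set Ω := fun r k => {ω | Y k ω = []} ∩ {ω | (r : ℝ) ≤ localTime Y W k [] ω}
    with hD
  set E : Set Ω := {ω | ∀ r : ℕ, ∃ j, Y j ω = [] ∧ (r : ℝ) ≤ localTime Y W j [] ω} with hE
  have hDm : ∀ r k, MeasurableSet[history Y W k] (D r k) := fun r k =>
    MeasurableSet.inter (measurableSet_position_eq Y W le_rfl _)
      (measurableSet_le measurable_const (measurable_localTime Y W k []))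
  have hDm' : ∀ r k, MeasurableSet (D r k) := fun r k => h.history_le _ _ (hDm r k)
  have hU : ∀ r, MeasurableSet (⋃ k, D r k) := fun r => MeasurableSet.iUnion (hDm' r)
  have hEeq : E = ⋂ r, ⋃ k, D r k := by
    ext ω
    simp [hE, hD]
  have hEm : MeasurableSet E := hEeq ▸ MeasurableSet.iInter hU
  have hanti : Antitone fun r => ⋃ k, D r k := by
    intro r s hrs
    refine iUnion_mono fun k ω hω => ⟨hω.1, ?_⟩
    have h1 : (s : ℝ) ≤ localTime Y W k [] ω := hω.2
    exact le_trans (Nat.cast_le.2 hrs) h1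
  -- Decompose according to the first visit to the root with local time at least `r`.
  have hbound : ∀ r, P (⋃ k, D r k) ≤ 8 * P ((⋃ k, D r k) \ E) := by
    intro r
    have hdm : ∀ k, MeasurableSet[history Y W k] (disjointed (D r) k) := by
      intro k
      rw [disjointed_eq_inter_compl]
      exact (hDm r k).inter (MeasurableSet.iInter fun j => MeasurableSet.iInter fun hj =>
        (history_mono Y W hj.le _ (hDm r j)).compl)
    have hdm' : ∀ k, MeasurableSet (disjointed (D r) k) := fun k => h.history_le _ _ (hdm k)
    rw [← iUnion_disjointed, iUnion_sdiff, measure_iUnion (disjoint_disjointed _) hdm',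
      measure_iUnion (fun i j hij => (disjoint_disjointed (D r) hij).mono sdiff_subset sdiff_subset)
        fun k => (hdm' k).diff hEm, ← ENNReal.tsum_mul_left]
    exact ENNReal.tsum_le_tsum fun k =>
      h.measure_le_eight_mul (hdm k) fun ω hω => (disjointed_le (D r) k hω).1
  have hlim : Filter.Tendsto (fun r => P (⋃ k, D r k)) Filter.atTop (nhds (P E)) := by
    rw [hEeq]
    exact tendsto_measure_iInter_atTop (fun r => (hU r).nullMeasurableSet) hanti
      ⟨0, measure_ne_top _ _⟩
  have hlim2 : Filter.Tendsto (fun r => P ((⋃ k, D r k) \ E)) Filter.atTop (nhds 0) := by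
    have h1 : ∀ r, P ((⋃ k, D r k) \ E) = P (⋃ k, D r k) - P E := fun r =>
      measure_sdiff (hEeq ▸ iInter_subset _ r) hEm.nullMeasurableSet (measure_ne_top _ _)
    simp_rw [h1]
    have := ENNReal.Tendsto.sub hlim (tendsto_const_nhds (x := P E)) (Or.inl (measure_ne_top P E))
    simpa using this
  have hE0 : P E ≤ 8 * 0 := le_of_tendsto_of_tendsto' hlim
    (ENNReal.Tendsto.const_mul hlim2 (Or.inr (by simp))) hbound
  rw [mul_zero, nonpos_iff_eq_zero] at hE0
  filter_upwards [measure_eq_zero_iff_ae_notMem.1 hE0] with ω hω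
  simp only [hE, mem_ofPred_eq, not_forall, not_exists, not_and, not_le] at hω
  exact hω

/-- The local time of the root grows only during visits to the root. -/
theorem IsVRJPWith.ae_bddAbove_localTime_nil (h : IsVRJPWith (aryTree 3) [] P X Y W) :
    ∀ᵐ ω ∂P, BddAbove (range fun j => localTime Y W j [] ω) := by
  filter_upwards [h.ae_exists_forall_lt] with ω ⟨r, hr⟩
  by_cases hex : ∃ i, (r : ℝ) ≤ localTime Y W i [] ω
  · obtain ⟨i, hi⟩ := hex
    have hconst : ∀ m, localTime Y W (i + m) [] ω = localTime Y W i [] ω := by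
      intro m
      induction m with
      | zero => rfl
      | succ m ih =>
        rw [← add_assoc, localTime_succ, ih, if_neg, add_zero]
        intro hY
        have := hr _ hY
        rw [ih] at this
        linarith
    refine ⟨localTime Y W i [] ω, ?_⟩
    rintro _ ⟨j, rfl⟩
    rcases le_total i j with hij | hij
    · obtain ⟨m, rfl⟩ := Nat.exists_eq_add_of_le hij
      exact (hconst m).le
    · exact localTime_mono Y W [] ω hij
  · push Not at hex
    exact ⟨r, by rintro _ ⟨j, rfl⟩; exact (hex j).le⟩

end Transience

/-! ### Local times are bounded relative to that of the root -/

section Maximal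

variable {Ω : Type*} [mΩ : MeasurableSpace Ω] {P : Measure Ω}

/-- Doob's maximal inequality for the exit from the decreasing events `C i`. -/
theorem mul_measure_add_le_of_stopping {Φ : ℕ → Ω → ENNReal} {c : ENNReal} {C : ℕ → Set Ω}
    (hCm : ∀ i, MeasurableSet (C i)) (hC : Antitone C)
    (hΦ : ∀ i, ∫⁻ ω in C i, Φ (i + 1) ω ∂P = ∫⁻ ω in C i, Φ i ω ∂P)
    (hc : ∀ i, ∀ ω ∈ C i \ C (i + 1), c ≤ Φ (i + 1) ω) (K : ℕ) :
    c * P (C 0 \ C K) + ∫⁻ ω in C K, Φ K ω ∂P ≤ ∫⁻ ω in C 0, Φ 0 ω ∂P := by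
  induction K with
  | zero => simp
  | succ K ih =>
    refine le_trans ?_ ih
    have h1 : c * P (C K \ C (K + 1)) ≤ ∫⁻ ω in C K \ C (K + 1), Φ (K + 1) ω ∂P := by
      rw [← setLIntegral_const]
      exact setLIntegral_mono' ((hCm K).diff (hCm (K + 1))) fun ω hω => hc K ω hω
    have h2 : P (C 0 \ C (K + 1)) ≤ P (C 0 \ C K) + P (C K \ C (K + 1)) := by
      refine (measure_mono fun ω hω => ?_).trans (measure_union_le _ _)
      by_cases hω' : ω ∈ C K
      · exact Or.inr ⟨hω', hω.2⟩
      · exact Or.inl ⟨hω.1, hω'⟩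
    rw [← hΦ K, ← lintegral_inter_add_sdiff _ (C K) (hCm (K + 1)),
      inter_eq_self_of_subset_right (hC K.le_succ)]
    calc _ ≤ c * (P (C 0 \ C K) + P (C K \ C (K + 1))) + ∫⁻ ω in C (K + 1), Φ (K + 1) ω ∂P :=
          add_le_add (mul_le_mul_right h2 c) le_rfl
      _ ≤ c * P (C 0 \ C K) + ∫⁻ ω in C K \ C (K + 1), Φ (K + 1) ω ∂P +
            ∫⁻ ω in C (K + 1), Φ (K + 1) ω ∂P := by
          rw [mul_add]
          exact add_le_add (add_le_add le_rfl h1) le_rfl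
      _ = _ := by ring

variable [IsProbabilityMeasure P] {b : ℕ}
  {X : ℝ≥0 → Ω → List (Fin b)} {Y : ℕ → Ω → List (Fin b)} {W : ℕ → Ω → ℝ≥0}

theorem IsVRJPWith.ae_bddAbove_pathProduct (h : IsVRJPWith (aryTree b) [] P X Y W) (hb : 0 < b)
    (v : List (Fin b)) :
    ∀ᵐ ω ∂P, BddAbove (range fun j => pathProduct v (Y j ω) (localTime Y W j · ω)) := by
  set F : ℕ → Ω → ℝ := fun j ω => pathProduct v (Y j ω) (localTime Y W j · ω) with hF
  have hFm : ∀ j, Measurable[history Y W j] (F j) := fun j =>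
    measurable_edgeProduct_history (fun _ _ => isEdgeMartingale_firstMoment) Y W j
  have hbound : ∀ r : ℕ, r * P {ω | ¬ BddAbove (range fun j => F j ω)} ≤ 1 := by
    intro r
    set C : ℕ → Set Ω := fun i => ⋂ j, ⋂ _ : j < i, {ω | F (j + 1) ω < r} with hC
    have hCm : ∀ i, MeasurableSet[history Y W i] (C i) := fun i =>
      MeasurableSet.iInter fun j => MeasurableSet.iInter fun hj =>
        measurableSet_lt ((hFm (j + 1)).mono (history_mono Y W (by omega)) le_rfl) measurable_const
    have hCm' : ∀ i, MeasurableSet (C i) := fun i => h.history_le _ _ (hCm i)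
    have hanti : Antitone C := by
      intro i j hij ω hω
      simp only [hC, mem_iInter] at hω ⊢
      exact fun l hl => hω l (hl.trans_le hij)
    have hC0 : C 0 = univ := by simp [hC]
    have hK := mul_measure_add_le_of_stopping (P := P) (Φ := fun j ω => ENNReal.ofReal (F j ω))
      (c := r) hCm' hanti ?_ ?_
    · have hstart : ∫⁻ ω in C 0, ENNReal.ofReal (F 0 ω) ∂P = 1 := by
        rw [hC0, Measure.restrict_univ]
        calc _ = ∫⁻ _, 1 ∂P := by
              refine lintegral_congr_ae ?_
              filter_upwards [h.start] with ω hω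
              simp only [hF, hω]
              rw [pathProduct_nil v fun u => localTime_pos Y W 0 u ω, localTime_zero,
                localTime_zero]
              simp
          _ = 1 := by simp
      rw [hstart] at hK
      have hlim : Filter.Tendsto (fun K => (r : ENNReal) * P (C 0 \ C K)) Filter.atTop
          (nhds (r * P (⋃ K, C 0 \ C K))) := by
        refine ENNReal.Tendsto.const_mul (tendsto_measure_iUnion_atTop ?_) (Or.inr (by simp))
        exact fun i j hij => sdiff_subset_sdiff_right (hanti hij)
      refine le_trans (mul_le_mul_right (measure_mono ?_) _)
        (le_of_tendsto' hlim fun K => le_self_add.trans (hK K))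
      intro ω hω
      have h1 : ∃ j, (r : ℝ) ≤ F (j + 1) ω := by
        by_contra hne
        push Not at hne
        refine hω ⟨max (F 0 ω) r, ?_⟩
        rintro _ ⟨j, rfl⟩
        cases j with
        | zero => exact le_max_left _ _
        | succ j => exact (hne j).le.trans (le_max_right _ _)
      obtain ⟨j, hj⟩ := h1
      refine mem_iUnion.2 ⟨j + 1, by simp [hC0], fun hmem => ?_⟩
      exact absurd (mem_iInter₂.1 hmem j j.lt_succ_self) (not_lt.2 hj)
    · intro i
      have := h.lintegral_edgeProduct_succ hb (g := fun _ => firstMoment) (C := pathEdges v)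
        (fun _ _ => isEdgeMartingale_firstMoment) (nil_notMem_pathEdges v) i
        (u := (C i).indicator fun _ => 1) (Measurable.indicator measurable_const (hCm i))
      rw [lintegral_indicator_mul (hCm' i), lintegral_indicator_mul (hCm' i)] at this
      simpa [hF, pathProduct] using this
    · intro i ω hω
      have h1 : (r : ℝ) ≤ F (i + 1) ω := by
        by_contra hne
        refine hω.2 (mem_iInter₂.2 fun j hj => ?_)
        rcases Nat.lt_succ_iff_lt_or_eq.1 hj with hj | rfl
        · exact (mem_iInter₂.1 hω.1) j hj
        · exact not_le.1 hne
      simpa using ENNReal.ofReal_le_ofReal h1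
  rw [ae_iff]
  by_contra hne
  obtain ⟨r, hr⟩ := ENNReal.exists_nat_mul_gt hne ENNReal.one_ne_top
  exact absurd (hbound r) (not_le.2 hr)

end Maximal

/-! ### Infinitely many visits contain long stays -/

section LongStays

variable {V Ω : Type*} [mΩ : MeasurableSpace Ω] {G : SimpleGraph V} [G.LocallyFinite] {ρ : V}
  {P : Measure Ω} {X : ℝ≥0 → Ω → V} {Y : ℕ → Ω → V} {W : ℕ → Ω → ℝ≥0}

/-- The conditional probability that a stay in `U` lasts longer than `1`. -/
theorem IsVRJPWith.condExp_one_lt_holding [Countable V] [IsProbabilityMeasure P]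
    (h : IsVRJPWith G ρ P X Y W) (hG : ∀ x, (G.neighborFinset x).Nonempty) (n : ℕ) (U : Set V) :
    P⟦{ω | Y n ω ∈ U ∧ 1 < W n ω} | history Y W n⟧ =ᵐ[P] {ω | Y n ω ∈ U}.indicator
      fun ω => Real.exp (-exitRate G (Y n ω) (localTime Y W n · ω)) := by
  have hle := h.history_le n
  have hUm : MeasurableSet[history Y W n] {ω | Y n ω ∈ U} :=
    measurable_position_history Y W le_rfl (t := U) trivial
  have hWm : MeasurableSet {ω | 1 < W n ω} :=
    measurableSet_lt measurable_const (h.measurable_holding n)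
  have hRm : Measurable[history Y W n] fun ω => exitRate G (Y n ω) (localTime Y W n · ω) := by
    have : Measurable[(⊤ : MeasurableSpace V).prod (history Y W n)] fun e : V × Ω =>
        exitRate G e.1 (localTime Y W n · e.2) :=
      @measurable_from_prod_countable_right V Ω ℝ ⊤ (history Y W n) _ _
        (@MeasurableSingletonClass.mk V ⊤ fun _ => trivial) _ fun x =>
        measurable_exitRate Y W n x
    exact this.comp (@Measurable.prodMk _ (history Y W n) _ _ ⊤ (history Y W n) _ _
      (measurable_position_history Y W le_rfl) measurable_id)
  have hfm : Measurable[history Y W n] ({ω | Y n ω ∈ U}.indicator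
      fun ω => Real.exp (-exitRate G (Y n ω) (localTime Y W n · ω))) :=
    (Real.measurable_exp.comp hRm.neg).indicator hUm
  have hR0 : ∀ ω, 0 ≤ exitRate G (Y n ω) (localTime Y W n · ω) := fun ω =>
    (exitRate_pos (hG _) n ω).le
  have hfint : Integrable ({ω | Y n ω ∈ U}.indicator
      fun ω => Real.exp (-exitRate G (Y n ω) (localTime Y W n · ω))) P := by
    refine Integrable.of_bound (hfm.mono hle le_rfl).aestronglyMeasurable 1
      (Filter.Eventually.of_forall fun ω => ?_)
    by_cases hω : Y n ω ∈ U
    · simp [hω, hR0 ω]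
    · simp [hω]
  refine (ae_eq_condExp_of_forall_setIntegral_eq hle
    ((integrable_const (1 : ℝ)).indicator ((hle _ hUm).inter hWm))
    (fun s _ _ => hfint.integrableOn) ?_ hfm.aestronglyMeasurable).symm
  intro C hC _
  have hstep := h.lintegral_step hG n
    (H := fun _ _ ω w => (C ∩ {ω | Y n ω ∈ U}).indicator 1 ω * (Ioi (1 : ℝ)).indicator 1 w) ?_
  · have hleft : ∫⁻ ω, (C ∩ {ω | Y n ω ∈ U}).indicator 1 ω *
        (Ioi (1 : ℝ)).indicator 1 (W n ω : ℝ) ∂P = P (C ∩ {ω | Y n ω ∈ U ∧ 1 < W n ω}) := by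
      have hm : MeasurableSet (C ∩ {ω | Y n ω ∈ U ∧ 1 < W n ω}) :=
        (hle _ hC).inter ((hle _ hUm).inter hWm)
      rw [← lintegral_indicator_one hm]
      refine lintegral_congr fun ω => ?_
      by_cases h1 : ω ∈ C <;> by_cases h2 : Y n ω ∈ U <;> by_cases h3 : 1 < W n ω <;>
        simp [indicator, h1, h2, h3]
    have hright : ∀ ω, ∑ y ∈ G.neighborFinset (Y n ω), ∫⁻ w in Ioi (0 : ℝ),
        ENNReal.ofReal (localTime Y W n y ω *
          Real.exp (-(exitRate G (Y n ω) (localTime Y W n · ω) * w))) *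
          ((C ∩ {ω | Y n ω ∈ U}).indicator 1 ω * (Ioi (1 : ℝ)).indicator 1 w) =
        C.indicator (fun ω => ENNReal.ofReal (({ω | Y n ω ∈ U}.indicator
          fun ω => Real.exp (-exitRate G (Y n ω) (localTime Y W n · ω))) ω)) ω := by
      intro ω
      have hR := exitRate_pos (Y := Y) (W := W) (hG (Y n ω)) n ω
      have hterm : ∀ y, ∫⁻ w in Ioi (0 : ℝ), ENNReal.ofReal (localTime Y W n y ω *
          Real.exp (-(exitRate G (Y n ω) (localTime Y W n · ω) * w))) *
          (Ioi (1 : ℝ)).indicator 1 w = ENNReal.ofReal (localTime Y W n y ω /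
            exitRate G (Y n ω) (localTime Y W n · ω) *
              Real.exp (-(exitRate G (Y n ω) (localTime Y W n · ω)))) := by
        intro y
        have hIoi : Ioi (1 : ℝ) ∩ Ioi 0 = Ioi 1 :=
          inter_eq_left.2 (Ioi_subset_Ioi zero_le_one)
        have hexp := lintegral_Ioi_mul_exp_neg_mul (localTime_pos Y W n y ω).le hR 1
        rw [mul_one] at hexp
        rw [← hexp, ← hIoi, ← setLIntegral_indicator measurableSet_Ioi]
        refine lintegral_congr fun w => ?_
        by_cases hw : 1 < w <;> simp [indicator, hw]
      by_cases h1 : ω ∈ C ∩ {ω | Y n ω ∈ U}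
      · have h2 : Y n ω ∈ U := h1.2
        simp only [indicator_of_mem h1, Pi.one_apply, one_mul, hterm]
        rw [← ENNReal.ofReal_sum_of_nonneg fun y _ => by
          have := localTime_pos Y W n y ω
          positivity, ← Finset.sum_mul, ← Finset.sum_div,
          show ∑ y ∈ G.neighborFinset (Y n ω), localTime Y W n y ω =
            exitRate G (Y n ω) (localTime Y W n · ω) from rfl, div_self hR.ne', one_mul]
        simp [indicator, h1.1, h2]
      · simp only [indicator_of_notMem h1, zero_mul, mul_zero, lintegral_zero,
          Finset.sum_const_zero]
        by_cases h2 : ω ∈ C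
        · have h3 : Y n ω ∉ U := fun h3 => h1 ⟨h2, h3⟩
          simp [indicator, h3]
        · simp [h2]
    rw [hleft, lintegral_congr hright, lintegral_indicator (hle _ hC)] at hstep
    rw [setIntegral_indicator ((hle _ hUm).inter hWm), integral_eq_lintegral_of_nonneg_ae
      (Filter.Eventually.of_forall fun ω => indicator_nonneg (fun _ _ => (Real.exp_pos _).le) ω)
      hfint.aestronglyMeasurable.restrict, ← hstep]
    simp only [integral_const, measureReal_restrict_apply_univ, smul_eq_mul, mul_one]
    rfl
  · intro _ _
    refine Measurable.mul ?_ ?_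
    · exact (@Measurable.indicator Ω ENNReal (C ∩ {ω | Y n ω ∈ U}) 1
        (history Y W n) _ _ (@measurable_one _ _ _ (history Y W n) _)
        (MeasurableSet.inter hC hUm)).comp
        (@measurable_fst Ω ℝ (history Y W n) Real.measurableSpace)
    · exact (measurable_one.indicator measurableSet_Ioi).comp
        (@measurable_snd Ω ℝ (history Y W n) Real.measurableSpace)

/-- If the process is in `U` infinitely often while the exit rates stay bounded, then infinitely
many of these stays in `U` last longer than `1`. -/
theorem IsVRJPWith.ae_frequently_one_lt_holding [Countable V] [IsProbabilityMeasure P]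
    (h : IsVRJPWith G ρ P X Y W) (hG : ∀ x, (G.neighborFinset x).Nonempty) (U : Set V) :
    ∀ᵐ ω ∂P, ∀ c : ℝ, (∃ᶠ n in Filter.atTop,
      Y n ω ∈ U ∧ exitRate G (Y n ω) (localTime Y W n · ω) ≤ c) →
        ∃ᶠ n in Filter.atTop, Y n ω ∈ U ∧ 1 < W n ω := by
  -- The event of the stay number `n` is known at the jump `n + 1`; the event of index `0` is empty.
  set s : ℕ → Set Ω := fun n => Nat.casesOn n ∅ fun n => {ω | Y n ω ∈ U ∧ 1 < W n ω} with hs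
  have hsm : ∀ n, MeasurableSet[historyFiltration Y W h.measurable_position h.measurable_holding n]
      (s n) := by
    intro n
    cases n with
    | zero => exact @MeasurableSet.empty _ (history Y W 0)
    | succ n =>
      exact MeasurableSet.inter
        (measurable_position_history Y W n.le_succ (t := U) trivial)
        ((measurable_holding_history Y W n.lt_succ_self) measurableSet_Ioi)
  have hcond := ae_all_iff.2 fun n => h.condExp_one_lt_holding hG n U
  filter_upwards [ae_mem_limsup_atTop_iff P hsm, hcond] with ω hω hc c hfreq
  set f : ℕ → ℝ := fun n => {ω | Y n ω ∈ U}.indicator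
    (fun ω => Real.exp (-exitRate G (Y n ω) (localTime Y W n · ω))) ω with hf
  have hf0 : ∀ n, 0 ≤ f n := fun n => indicator_nonneg (fun _ _ => (Real.exp_pos _).le) ω
  have hdiv : Filter.Tendsto (fun n => ∑ k ∈ Finset.range n, f k) Filter.atTop Filter.atTop := by
    rw [← not_summable_iff_tendsto_nat_atTop_of_nonneg hf0]
    intro hsum
    have hlt := hsum.tendsto_atTop_zero.eventually (gt_mem_nhds (Real.exp_pos (-c)))
    obtain ⟨n, ⟨hn1, hn2⟩, hn3⟩ := (hfreq.and_eventually hlt).exists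
    have h1 : f n = Real.exp (-exitRate G (Y n ω) (localTime Y W n · ω)) :=
      indicator_of_mem (s := {ω | Y n ω ∈ U}) hn1 _
    rw [h1, Real.exp_lt_exp] at hn3
    linarith
  have hmem : ω ∈ Filter.limsup s Filter.atTop := by
    refine hω.2 (hdiv.congr fun n => Finset.sum_congr rfl fun k _ => (hc k).symm)
  rw [Filter.mem_limsup_iff_frequently_mem] at hmem
  rw [Filter.frequently_atTop] at hmem ⊢
  intro n
  obtain ⟨m, hm, hmω⟩ := hmem (n + 1)
  cases m with
  | zero => exact absurd hmω (notMem_empty ω)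
  | succ m => exact ⟨m, by omega, hmω⟩

/-- A sequence of nonnegative numbers with infinitely many terms above `1` has unbounded sums. -/
theorem not_bddAbove_sum_range_of_frequently {f : ℕ → ℝ} (hf : ∀ n, 0 ≤ f n)
    (h : ∃ᶠ n in Filter.atTop, 1 < f n) :
    ¬ BddAbove (range fun n => ∑ k ∈ Finset.range n, f k) := by
  rintro ⟨c, hc⟩
  have hsum := summable_of_sum_range_le hf fun n => hc (mem_range_self n)
  have hlt := hsum.tendsto_atTop_zero.eventually (gt_mem_nhds zero_lt_one)
  obtain ⟨n, hn1, hn2⟩ := (h.and_eventually hlt).exists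
  linarith

end LongStays

/-! ### No explosion, finitely many visits, and transience -/

section Conclusion

theorem exists_jumpTime_le_lt {Ω : Type*} {W : ℕ → Ω → ℝ≥0} {ω : Ω} {t : ℝ≥0}
    (h : ∃ n, t < jumpTime W n ω) :
    ∃ n, jumpTime W n ω ≤ t ∧ t < jumpTime W (n + 1) ω := by
  classical
  have hspec := Nat.find_spec h
  have hmin : ∀ m < Nat.find h, ¬ t < jumpTime W m ω := fun m hm => Nat.find_min h hm
  generalize Nat.find h = N at hspec hmin
  cases N with
  | zero => simp [jumpTime] at hspec
  | succ n => exact ⟨n, not_lt.1 (hmin n n.lt_succ_self), hspec⟩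

variable {Ω : Type*} [mΩ : MeasurableSpace Ω] {P : Measure Ω} [IsProbabilityMeasure P]

theorem card_aryTree_neighborFinset_le (b : ℕ) (x : List (Fin b)) :
    ((aryTree b).neighborFinset x).card ≤ b + 1 := by
  have hsub : (aryTree b).neighborFinset x ⊆
      insert x.tail (Finset.univ.image fun i : Fin b => i :: x) := by
    intro y hy
    rcases (SimpleGraph.mem_neighborFinset _ _ _).1 hy with ⟨i, rfl⟩ | ⟨i, rfl⟩ <;> simp
  refine (Finset.card_le_card hsub).trans ((Finset.card_insert_le _ _).trans ?_)
  have := Finset.card_image_le (s := (Finset.univ : Finset (Fin b))) (f := fun i => i :: x)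
  simpa using this

/-- The process does not explode: if the jump times were bounded, so would be the local times and
hence the exit rates, and infinitely many stays would last longer than `1`. -/
theorem IsVRJPWith.ae_not_bddAbove_jumpTime {b : ℕ} {X : ℝ≥0 → Ω → List (Fin b)}
    {Y : ℕ → Ω → List (Fin b)} {W : ℕ → Ω → ℝ≥0} (h : IsVRJPWith (aryTree b) [] P X Y W)
    (hb : 0 < b) : ∀ᵐ ω ∂P, ∀ t : ℝ≥0, ∃ n, t < jumpTime W n ω := by
  filter_upwards [h.ae_frequently_one_lt_holding (aryTree_neighborFinset_nonempty hb) univ]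
    with ω hω t
  by_contra! hne
  have hrate : ∀ n, exitRate (aryTree b) (Y n ω) (localTime Y W n · ω) ≤ (b + 1) * (1 + t) := by
    intro n
    have h1 : ∀ y ∈ (aryTree b).neighborFinset (Y n ω), localTime Y W n y ω ≤ 1 + t := by
      intro y _
      have h2 : (jumpTime W n ω : ℝ) ≤ t := hne n
      linarith [localTime_le_one_add_jumpTime Y W n y ω]
    refine (Finset.sum_le_card_nsmul _ _ _ h1).trans ?_
    rw [nsmul_eq_mul]
    gcongr
    exact_mod_cast card_aryTree_neighborFinset_le b _
  have hfreq := hω _ (Filter.Frequently.of_forall fun n => ⟨mem_univ _, hrate n⟩)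
  refine not_bddAbove_sum_range_of_frequently (f := fun n => (W n ω : ℝ))
    (fun n => NNReal.coe_nonneg _) (hfreq.mono fun n hn => by exact_mod_cast hn.2) ⟨t, ?_⟩
  rintro _ ⟨n, rfl⟩
  have := hne n
  rw [jumpTime] at this
  exact_mod_cast this

/-- If the local time of the root is bounded then so are all local times, because `pathProduct v` is
bounded, and every vertex is visited finitely often. -/
theorem IsVRJPWith.ae_finite_visits {b : ℕ} {X : ℝ≥0 → Ω → List (Fin b)}
    {Y : ℕ → Ω → List (Fin b)} {W : ℕ → Ω → ℝ≥0} (h : IsVRJPWith (aryTree b) [] P X Y W)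
    (hb : 0 < b)
    (hbdd : ∀ᵐ ω ∂P, BddAbove (range fun j => localTime Y W j [] ω)) :
    ∀ᵐ ω ∂P, ∀ v, {j | Y j ω = v}.Finite := by
  have hstay := ae_all_iff.2 fun v : List (Fin b) =>
    h.ae_frequently_one_lt_holding (aryTree_neighborFinset_nonempty hb) {v}
  filter_upwards [hbdd, hstay, ae_all_iff.2 fun v => h.ae_bddAbove_pathProduct hb v]
    with ω hroot hlong hpath v
  have hall : ∀ u, ∃ c, ∀ j, localTime Y W j u ω ≤ c := by
    intro u
    obtain ⟨c, hc⟩ := hroot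
    obtain ⟨c', hc'⟩ := hpath u
    refine ⟨c' * c, fun j => ?_⟩
    have h1 : localTime Y W j [] ω ≤ c := hc (mem_range_self j)
    have h2 : pathProduct u (Y j ω) (localTime Y W j · ω) ≤ c' := hc' (mem_range_self j)
    have h3 := div_le_pathProduct u (Y j ω) fun x => localTime_pos Y W j x ω
    have h4 := localTime_pos Y W j [] ω
    have h5 := localTime_pos Y W j u ω
    rw [div_le_iff₀ h4] at h3
    have h6 : 0 ≤ c' := (pathProduct_nonneg u (Y j ω) fun x => localTime_pos Y W j x ω).trans h2
    nlinarith
  by_contra hinf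
  have hfreq : ∃ᶠ n in Filter.atTop, Y n ω = v := Nat.frequently_atTop_iff_infinite.2 hinf
  choose c hc using hall
  have hlong' := hlong v (∑ y ∈ (aryTree b).neighborFinset v, c y) (hfreq.mono fun n hn => by
    rw [hn]
    exact ⟨rfl, Finset.sum_le_sum fun y _ => hc y n⟩)
  classical
  refine not_bddAbove_sum_range_of_frequently
    (f := fun n => if Y n ω = v then (W n ω : ℝ) else 0)
    (fun n => by split_ifs <;> simp) (hlong'.mono fun n hn => ?_) ⟨c v, ?_⟩
  · have h1 : Y n ω = v := hn.1
    rw [if_pos h1]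
    exact_mod_cast hn.2
  · rintro _ ⟨n, rfl⟩
    have h1 := hc v n
    have h2 : (∑ k ∈ Finset.range n, if Y k ω = v then (W k ω : ℝ) else 0) =
        localTime Y W n v ω - 1 := by
      rw [localTime, add_sub_cancel_left]
      exact Finset.sum_congr rfl fun k _ => by congr
    simp only [h2]
    linarith

end Conclusion

theorem mainTheorem4 {Ω : Type*} [MeasurableSpace Ω] (P : Measure Ω) [IsProbabilityMeasure P]
    (X : ℝ≥0 → Ω → List (Fin 3)) (hX : IsVRJP (aryTree 3) [] P X) :
    IsTransient [] P X ∧ DriftsToInfinity P X := by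
  obtain ⟨Y, W, h⟩ := hX
  have htime := h.ae_not_bddAbove_jumpTime (by norm_num)
  constructor
  · refine h.measure_no_return_pos.trans_le (measure_mono_ae ?_)
    filter_upwards [htime, h.path] with ω hT hpath hω
    obtain ⟨h0, hne⟩ := hω
    refine ⟨jumpTime W 1 ω, fun t => ?_⟩
    obtain ⟨n, hn1, hn2⟩ := exists_jumpTime_le_lt (hT t)
    rw [hpath n t hn1 hn2]
    cases n with
    | zero => simpa [h0] using hn2
    | succ n =>
      have hmono : jumpTime W 1 ω ≤ jumpTime W (n + 1) ω :=
        Finset.sum_le_sum_of_subset (Finset.range_mono (by omega))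
      simpa [hne n] using hmono.trans hn1
  · have hfin := h.ae_finite_visits (by norm_num) h.ae_bddAbove_localTime_nil
    filter_upwards [htime, h.path, hfin] with ω hT hpath hY v
    refine ((hY v).image fun n => jumpTime W n ω).subset ?_
    rintro t ⟨htv, ht⟩
    obtain ⟨n, hn1, hn2⟩ := exists_jumpTime_le_lt (hT t)
    have hYn : Y n ω = v := by rw [← hpath n t hn1 hn2, htv]
    refine ⟨n, hYn, ?_⟩
    -- A visit can only begin at a jump time.
    by_contra hlt
    obtain ⟨s, hs, hsv⟩ := ht _ (lt_of_le_of_ne hn1 hlt)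
    exact hsv ((hpath n s hs.1 (hs.2.trans hn2)).trans hYn)
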